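/- Let $\alpha=1/2$ and $\theta=0$. Let $S$ be a locally compact, separable metric space and $\nu_0$ a diffuse Borel probability measure on $S$, i.e. $\nu_0(\{x\})=0$ for every $x\in S$. Let $\Pi=\Pi_{1/2,0,\nu_0}$ be the two-parameter Dirichlet process: the law, on the space $\mathcal P_1(S)$ of Borel probability measures on $S$, of $\sum_{k\ge1}P_k\delta_{\xi_k}$, where $\xi_1,\xi_2,\dots$ are i.i.d. with law $\nu_0$ and independent of $(P_k)_{k\ge1}$, and $(P_k)_{k\ge1}$ is the descending rearrangement of the sequence $V_n=(1-U_1)\cdots(1-U_{n-1})U_n$, $n\ge1$, with independent $U_n\sim\mathrm{Beta}(1-\alpha,\theta+n\alpha)=\mathrm{Beta}(1/2,n/2)$. Let $\mathcal F$ be the set of cylinder functions $F(\mu)=f(\langle\phi_1,\mu\rangle,\dots,\langle\phi_d,\mu\rangle)$ on $\mathcal P_1(S)$, where $d\ge1$, $\phi_1,\dots,\phi_d$ are bounded Borel functions on $S$, $f\in C^\infty(\mathbb R^d)$ and $\langle\phi,\mu\rangle=\int_S\phi\,d\mu$. For such $F$ put $\nabla_xF(\mu)=\sum_{i=1}^d\partial_if(\langle\phi_1,\mu\rangle,\dots,\langle\phi_d,\mu\rangle)\,\phi_i(x)$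 and $\nabla F(\mu)=(x\mapsto\nabla_xF(\mu))$, and for $F,G\in\mathcal F$ let $$\mathcal E(F,G)=\frac12\int_{\mathcal P_1(S)}\langle\nabla F(\mu),\nabla G(\mu)\rangle_\mu\,\Pi(d\mu),\qquad \langle\phi,\psi\rangle_\mu=\int_S\phi\psi\,d\mu-\Big(\int_S\phi\,d\mu\Big)\Big(\int_S\psi\,d\mu\Big).$$ For each $k\ge1$ let $(B^k_1,\dots,B^k_{2^k})$ be a partition of $S$ into Borel sets such that, for all $k\ge1$ and $1\le j\le2^k$, $\nu_0(B^k_j)=2^{-k}$ and $B^k_j=B^{k+1}_{2j-1}\cup B^{k+1}_{2j}$. Let $H(\mu)=\langle1_{B^1_1},\mu\rangle=\mu(B^1_1)$. Then there is no $LH\in L^2(\mathcal P_1(S);\Pi)$ such that $$\mathcal E(H,G)=-\int_{\mathcal P_1(S)}LH(\mu)\,G(\mu)\,\Pi(d\mu)\qquad\text{for all }G\in\mathcal F.$$ In other words, $H\in\mathcal F$ is not in the domain of the pre-generator of $(\mathcal E,\mathcal F)$ on $L^2(\mathcal P_1(S);\Pi)$. -/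

import Mathlib

open MeasureTheory ProbabilityTheory
open scoped ENNReal ContDiff

noncomputable section

namespace TwoParameterDirichlet

/-! ### The two-parameter Dirichlet process -/

/-- The joint law of independent variables `U 0, U 1, …`, where `U n` (the `(n+1)`-st variable)
has the distribution `Beta(1 - α, θ + (n + 1) α)`. -/
def betaSequenceLaw (α θ : ℝ) : Measure (ℕ → ℝ) :=
  Measure.infinitePi fun n : ℕ => betaMeasure (1 - α) (θ + ((n : ℝ) + 1) * α)

/-- Stick breaking: `V n = (1 - U 0) ⋯ (1 - U (n - 1)) * U n`. -/
def stickBreaking (U : ℕ → ℝ) (n : ℕ) : ℝ :=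
  (∏ i ∈ Finset.range n, (1 - U i)) * U n

/-- The descending rearrangement of a sequence: its value at `k` is the `(k+1)`-st largest entry,
counted with multiplicity, i.e. the largest `t` (a supremum, in general) such that at least `k + 1`
entries are `≥ t`. -/
def descending (v : ℕ → ℝ≥0∞) (k : ℕ) : ℝ≥0∞ :=
  ⨆ A : {A : Finset ℕ // A.card = k + 1}, ⨅ i : {i // i ∈ A.1}, v i.1

/-- The ranked weights `P k`: the stick-breaking weights of `U` in descending order. -/
def rankedWeights (U : ℕ → ℝ) : ℕ → ℝ≥0∞ :=
  descending fun n => ENNReal.ofReal (stickBreaking U n)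

variable {S : Type*} [MeasurableSpace S]

/-- The atomic measure `∑ k, P k • δ_{ξ k}`. -/
def atomicMeasure (p : (ℕ → ℝ) × (ℕ → S)) : Measure S :=
  Measure.sum fun k => rankedWeights p.1 k • Measure.dirac (p.2 k)

open Classical in
/-- The random probability measure `∑ k, P k • δ_{ξ k}`. On the null event where the weights do not
add up to one, it is given the irrelevant value `ν₀`. -/
def randomMeasure (ν₀ : ProbabilityMeasure S) (p : (ℕ → ℝ) × (ℕ → S)) : ProbabilityMeasure S :=
  if h : IsProbabilityMeasure (atomicMeasure p) then ⟨atomicMeasure p, h⟩ else ν₀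

/-- The two-parameter Dirichlet process `Π_{α,θ,ν₀}`: the law of `∑ k, P k • δ_{ξ k}`, where the
`ξ k` are i.i.d. with law `ν₀` and independent of the ranked weights `P`. -/
def dirichletLaw (α θ : ℝ) (ν₀ : ProbabilityMeasure S) : Measure (ProbabilityMeasure S) :=
  Measure.map (randomMeasure ν₀)
    ((betaSequenceLaw α θ).prod (Measure.infinitePi fun _ : ℕ => (ν₀ : Measure S)))

theorem measurable_rankedWeights (k : ℕ) : Measurable fun U : ℕ → ℝ => rankedWeights U k := by
  refine Measurable.iSup fun A => Measurable.iInf fun i => ?_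
  unfold stickBreaking
  fun_prop

theorem measurable_atomicMeasure :
    Measurable (atomicMeasure : (ℕ → ℝ) × (ℕ → S) → Measure S) := by
  refine Measure.measurable_of_measurable_coe _ fun s hs => ?_
  simp only [atomicMeasure, Measure.sum_apply _ hs, Measure.smul_apply, smul_eq_mul]
  refine Measurable.tsum fun k => ?_
  refine ((measurable_rankedWeights k).comp measurable_fst).mul ?_
  exact (Measure.measurable_coe hs).comp (Measure.measurable_dirac.comp (by fun_prop))

/-- The random measure is measurable, so that `dirichletLaw` is a genuine image measure. -/
theorem measurable_randomMeasure (ν₀ : ProbabilityMeasure S) :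
    Measurable (randomMeasure ν₀) := by
  classical
  refine Measurable.subtype_mk (f := fun p => (randomMeasure ν₀ p : Measure S)) ?_
  have h : (fun p => (randomMeasure ν₀ p : Measure S)) =
      fun p => if IsProbabilityMeasure (atomicMeasure p) then atomicMeasure p else ν₀ := by
    funext p
    by_cases hp : IsProbabilityMeasure (atomicMeasure p) <;> simp [randomMeasure, hp]
  rw [h]
  exact Measurable.ite
    (measurable_atomicMeasure ProbabilityMeasure.measurableSet_isProbabilityMeasure)
    measurable_atomicMeasure measurable_const

theorem isProbabilityMeasure_dirichletLaw {α θ : ℝ} (h0 : 0 ≤ α) (h1 : α < 1) (hθ : -α < θ)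
    (ν₀ : ProbabilityMeasure S) : IsProbabilityMeasure (dirichletLaw α θ ν₀) := by
  have (n : ℕ) : IsProbabilityMeasure (betaMeasure (1 - α) (θ + ((n : ℝ) + 1) * α)) :=
    isProbabilityMeasureBeta (by linarith)
      (by nlinarith [mul_nonneg (Nat.cast_nonneg (α := ℝ) n) h0])
  have : IsProbabilityMeasure (betaSequenceLaw α θ) := by
    unfold betaSequenceLaw; infer_instance
  exact Measure.isProbabilityMeasure_map (measurable_randomMeasure ν₀).aemeasurable

/-! ### Cylinder functions and the bilinear form -/

variable (S) in
/-- A cylinder function `F(μ) = f(⟨φ₁, μ⟩, …, ⟨φ_d, μ⟩)`, with `d ≥ 1`, bounded measurable `φᵢ`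
and `f ∈ C^∞(ℝ^d)`, given by these data. -/
structure CylinderFunction where
  dim : ℕ
  one_le_dim : 1 ≤ dim
  φ : Fin dim → S → ℝ
  measurable_φ : ∀ i, Measurable (φ i)
  bounded_φ : ∀ i, ∃ C : ℝ, ∀ x, |φ i x| ≤ C
  f : (Fin dim → ℝ) → ℝ
  contDiff_f : ContDiff ℝ ∞ f

namespace CylinderFunction

/-- The vector `(⟨φ₁, μ⟩, …, ⟨φ_d, μ⟩)`. -/
def coords (F : CylinderFunction S) (μ : ProbabilityMeasure S) : Fin F.dim → ℝ :=
  fun i => ∫ x, F.φ i x ∂(μ : Measure S)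

/-- The value `F(μ) = f(⟨φ₁, μ⟩, …, ⟨φ_d, μ⟩)`. -/
def eval (F : CylinderFunction S) (μ : ProbabilityMeasure S) : ℝ :=
  F.f (F.coords μ)

/-- The gradient `∇ₓF(μ) = ∑ᵢ ∂ᵢf(⟨φ₁, μ⟩, …, ⟨φ_d, μ⟩) φᵢ(x)`. -/
def grad (F : CylinderFunction S) (μ : ProbabilityMeasure S) (x : S) : ℝ :=
  ∑ i, fderiv ℝ F.f (F.coords μ) (Pi.single i 1) * F.φ i x

/-- The cylinder function `μ ↦ ⟨1_A, μ⟩ = μ(A)`. -/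
def mass (A : Set S) (hA : MeasurableSet A) : CylinderFunction S where
  dim := 1
  one_le_dim := le_rfl
  φ := fun _ => A.indicator 1
  measurable_φ := fun _ => measurable_one.indicator hA
  bounded_φ := fun _ => ⟨1, fun x => by by_cases h : x ∈ A <;> simp [h]⟩
  f := fun v => v 0
  contDiff_f := contDiff_apply ℝ ℝ 0

theorem eval_mass (A : Set S) (hA : MeasurableSet A) (μ : ProbabilityMeasure S) :
    (mass A hA).eval μ = (μ : Measure S).real A :=
  integral_indicator_one hA

end CylinderFunction

/-- `⟨φ, ψ⟩_μ = ∫ φ ψ dμ - (∫ φ dμ) (∫ ψ dμ)`. -/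
def covForm (μ : ProbabilityMeasure S) (φ ψ : S → ℝ) : ℝ :=
  (∫ x, φ x * ψ x ∂(μ : Measure S)) - (∫ x, φ x ∂(μ : Measure S)) * ∫ x, ψ x ∂(μ : Measure S)

/-- The bilinear form `𝓔(F, G) = (1/2) ∫ ⟨∇F(μ), ∇G(μ)⟩_μ Π(dμ)` on cylinder functions. -/
def energyForm (P : Measure (ProbabilityMeasure S)) (F G : CylinderFunction S) : ℝ :=
  (1 / 2) * ∫ μ, covForm μ (F.grad μ) (G.grad μ) ∂P

/-! ### The form depends on the functions only, not on the data that represent them -/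

namespace CylinderFunction

theorem integrable_φ (F : CylinderFunction S) (μ : ProbabilityMeasure S) (i : Fin F.dim) :
    Integrable (F.φ i) (μ : Measure S) := by
  obtain ⟨C, hC⟩ := F.bounded_φ i
  exact Integrable.of_bound (F.measurable_φ i).aestronglyMeasurable C (ae_of_all _ hC)

theorem measurable_grad (F : CylinderFunction S) (μ : ProbabilityMeasure S) :
    Measurable (F.grad μ) := by
  have := F.measurable_φ
  unfold grad
  fun_prop

theorem bounded_grad (F : CylinderFunction S) (μ : ProbabilityMeasure S) :
    ∃ C : ℝ, ∀ x, |F.grad μ x| ≤ C := by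
  choose C hC using F.bounded_φ
  refine ⟨∑ i, |fderiv ℝ F.f (F.coords μ) (Pi.single i 1)| * C i, fun x => ?_⟩
  refine (Finset.abs_sum_le_sum_abs _ _).trans (Finset.sum_le_sum fun i _ => ?_)
  rw [abs_mul]
  exact mul_le_mul_of_nonneg_left (hC i x) (abs_nonneg _)

theorem integrable_grad (F : CylinderFunction S) (μ : ProbabilityMeasure S) :
    Integrable (F.grad μ) (μ : Measure S) := by
  obtain ⟨C, hC⟩ := F.bounded_grad μ
  exact Integrable.of_bound (F.measurable_grad μ).aestronglyMeasurable C (ae_of_all _ hC)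

theorem integral_grad (F : CylinderFunction S) (μ : ProbabilityMeasure S) :
    ∫ x, F.grad μ x ∂(μ : Measure S) =
      ∑ i, fderiv ℝ F.f (F.coords μ) (Pi.single i 1) * F.coords μ i := by
  unfold grad
  rw [integral_finsetSum _ fun i _ => (F.integrable_φ μ i).const_mul _]
  simp only [integral_const_mul, coords]

theorem fderiv_apply_eq_sum (F : CylinderFunction S) (v w : Fin F.dim → ℝ) :
    fderiv ℝ F.f v w = ∑ i, fderiv ℝ F.f v (Pi.single i 1) * w i := by
  conv_lhs => rw [← Finset.univ_sum_single w]
  rw [map_sum]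
  refine Finset.sum_congr rfl fun i _ => ?_
  rw [mul_comm, ← smul_eq_mul, ← map_smul, ← Pi.single_smul', smul_eq_mul, mul_one]

theorem hasDerivAt_line (F : CylinderFunction S) (v w : Fin F.dim → ℝ) :
    HasDerivAt (fun s : ℝ => F.f (v + s • w)) (fderiv ℝ F.f v w) 0 := by
  have h1 : HasDerivAt (fun s : ℝ => v + s • w) w 0 := by
    simpa using ((hasDerivAt_id (0 : ℝ)).smul_const w).const_add v
  have h2 : HasFDerivAt F.f (fderiv ℝ F.f v) (v + (0 : ℝ) • w) := by
    simpa using (F.contDiff_f.differentiable (by simp) v).hasFDerivAt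
  exact h2.comp_hasDerivAt (0 : ℝ) h1

/-- `∇ₓF(μ)` is the derivative at `s = 0` of
`F(μ + s δₓ) = f(⟨φ₁, μ⟩ + s φ₁(x), …, ⟨φ_d, μ⟩ + s φ_d(x))`. -/
theorem hasDerivAt_grad (F : CylinderFunction S) (μ : ProbabilityMeasure S) (x : S) :
    HasDerivAt (fun s : ℝ => F.f fun i => F.coords μ i + s * F.φ i x) (F.grad μ x) 0 := by
  have h := F.hasDerivAt_line (F.coords μ) fun i => F.φ i x
  rwa [fderiv_apply_eq_sum] at h

/-- The mixture `(1 - s) μ + s δₓ`. -/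
def mix (μ : ProbabilityMeasure S) (x : S) (s : ℝ) (h0 : 0 ≤ s) (h1 : s ≤ 1) :
    ProbabilityMeasure S :=
  ⟨ENNReal.ofReal (1 - s) • (μ : Measure S) + ENNReal.ofReal s • Measure.dirac x, ⟨by
    simp [← ENNReal.ofReal_add (sub_nonneg.2 h1) h0]⟩⟩

theorem coords_mix (F : CylinderFunction S) (μ : ProbabilityMeasure S) (x : S) (s : ℝ)
    (h0 : 0 ≤ s) (h1 : s ≤ 1) :
    F.coords (mix μ x s h0 h1) = F.coords μ + s • ((fun i => F.φ i x) - F.coords μ) := by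
  funext i
  obtain ⟨C, hC⟩ := F.bounded_φ i
  have hd : Integrable (F.φ i) (Measure.dirac x) :=
    Integrable.of_bound (F.measurable_φ i).aestronglyMeasurable C (ae_of_all _ hC)
  change ∫ y, F.φ i y ∂(ENNReal.ofReal (1 - s) • (μ : Measure S) +
    ENNReal.ofReal s • Measure.dirac x) = _
  rw [integral_add_measure ((F.integrable_φ μ i).smul_measure ENNReal.ofReal_ne_top)
    (hd.smul_measure ENNReal.ofReal_ne_top), integral_smul_measure, integral_smul_measure,
    integral_dirac' _ _ (F.measurable_φ i).stronglyMeasurable,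
    ENNReal.toReal_ofReal (sub_nonneg.2 h1), ENNReal.toReal_ofReal h0]
  simp only [coords, Pi.add_apply, Pi.smul_apply, Pi.sub_apply, smul_eq_mul]
  ring

/-- Equal cylinder functions have gradients that differ by a constant in `x`. -/
theorem grad_sub_integral_congr {F F' : CylinderFunction S} (h : F.eval = F'.eval)
    (μ : ProbabilityMeasure S) (x : S) :
    F.grad μ x - ∫ y, F.grad μ y ∂(μ : Measure S) =
      F'.grad μ x - ∫ y, F'.grad μ y ∂(μ : Measure S) := by
  have key (F : CylinderFunction S) :
      F.grad μ x - ∫ y, F.grad μ y ∂(μ : Measure S) =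
        fderiv ℝ F.f (F.coords μ) ((fun i => F.φ i x) - F.coords μ) := by
    rw [integral_grad, map_sub, F.fderiv_apply_eq_sum _ (F.coords μ),
      F.fderiv_apply_eq_sum _ fun i => F.φ i x]
    rfl
  rw [key, key]
  have e1 := (F.hasDerivAt_line (F.coords μ)
    ((fun i => F.φ i x) - F.coords μ)).hasDerivWithinAt (s := Set.Icc 0 1)
  have e2 := (F'.hasDerivAt_line (F'.coords μ)
    ((fun i => F'.φ i x) - F'.coords μ)).hasDerivWithinAt (s := Set.Icc 0 1)
  have hu : UniqueDiffWithinAt ℝ (Set.Icc (0 : ℝ) 1) 0 :=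
    uniqueDiffOn_Icc zero_lt_one 0 (by simp)
  refine hu.eq_deriv _ e1 (e2.congr_of_mem (fun s hs => ?_) (by simp))
  have := congrFun h (mix μ x s hs.1 hs.2)
  simpa only [eval, coords_mix] using this

theorem covForm_grad_congr_left {F F' : CylinderFunction S} (h : F.eval = F'.eval)
    (G : CylinderFunction S) (μ : ProbabilityMeasure S) :
    covForm μ (F.grad μ) (G.grad μ) = covForm μ (F'.grad μ) (G.grad μ) := by
  have hF : F.grad μ = fun x => F'.grad μ x +
      (∫ y, F.grad μ y ∂(μ : Measure S) - ∫ y, F'.grad μ y ∂(μ : Measure S)) := by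
    funext x
    linarith [grad_sub_integral_congr h μ x]
  set c := ∫ y, F.grad μ y ∂(μ : Measure S) - ∫ y, F'.grad μ y ∂(μ : Measure S)
  obtain ⟨C, hC⟩ := F'.bounded_grad μ
  have i1 : Integrable (fun x => F'.grad μ x * G.grad μ x) (μ : Measure S) :=
    (G.integrable_grad μ).bdd_mul (F'.measurable_grad μ).aestronglyMeasurable (ae_of_all _ hC)
  rw [hF]
  simp only [covForm, add_mul]
  rw [integral_add i1 ((G.integrable_grad μ).const_mul c),
    integral_add (F'.integrable_grad μ) (integrable_const c), integral_const_mul]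
  simp
  ring

theorem energyForm_congr (P : Measure (ProbabilityMeasure S)) {F F' G G' : CylinderFunction S}
    (hF : F.eval = F'.eval) (hG : G.eval = G'.eval) :
    energyForm P F G = energyForm P F' G' := by
  have comm (μ : ProbabilityMeasure S) (φ ψ : S → ℝ) : covForm μ φ ψ = covForm μ ψ φ := by
    simp only [covForm, mul_comm]
  unfold energyForm
  congr 2
  funext μ
  rw [covForm_grad_congr_left hF, comm, covForm_grad_congr_left hG, comm]

end CylinderFunction

/-! ### Dyadic partitions -/

/-- `{(B k 1, …, B k (2^k))}`, `k ≥ 1`, is a sequence of measurable partitions of `S` with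
`ν₀(B k j) = 2^{-k}` and `B k j = B (k+1) (2j-1) ∪ B (k+1) (2j)`. (The sets `B k j` with `k = 0` or
`j` outside `{1, …, 2^k}` play no role.) -/
structure IsDyadicPartition (ν₀ : ProbabilityMeasure S) (B : ℕ → ℕ → Set S) : Prop where
  measurableSet : ∀ k, 1 ≤ k → ∀ j ∈ Finset.Icc 1 (2 ^ k), MeasurableSet (B k j)
  disjoint : ∀ k, 1 ≤ k → ∀ i ∈ Finset.Icc 1 (2 ^ k), ∀ j ∈ Finset.Icc 1 (2 ^ k),
    i ≠ j → Disjoint (B k i) (B k j)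
  iUnion_eq : ∀ k, 1 ≤ k → ⋃ j ∈ Finset.Icc 1 (2 ^ k), B k j = Set.univ
  measure_eq : ∀ k, 1 ≤ k → ∀ j ∈ Finset.Icc 1 (2 ^ k),
    (ν₀ : Measure S) (B k j) = 1 / 2 ^ k
  split : ∀ k, 1 ≤ k → ∀ j ∈ Finset.Icc 1 (2 ^ k), B k j = B (k + 1) (2 * j - 1) ∪ B (k + 1) (2 * j)

theorem IsDyadicPartition.measurableSet_one_one {ν₀ : ProbabilityMeasure S} {B : ℕ → ℕ → Set S}
    (hB : IsDyadicPartition ν₀ B) : MeasurableSet (B 1 1) :=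
  hB.measurableSet 1 le_rfl 1 (by simp)

end TwoParameterDirichlet

end

open MeasureTheory ProbabilityTheory
open scoped ENNReal ContDiff

noncomputable section

namespace TwoParameterDirichlet

/-! ### Descending rearrangements -/

/-! Suppose `LH` exists. The contradiction comes from test functions that imitate a square root of
the masses, because for α = 1/2 and θ = 0 the exponent 1/2 is exactly the one at which the power
sums of the weights cease to have finite expectation: E ∑ √P_i = ∞.

Take the N = 2^(k+1) blocks of level k+1, with masses M_j, signs s_j = 1 inside B^1_1 and s_j = -1
outside, and G = ∑ s_j φ(M_j), where φ is a smooth version of the square root with φ(v)² ≤ v. The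
law of (M_j) is exchangeable and the signs add up to zero, so in a signed double sum of nonnegative
terms the off-diagonal part has nonpositive mean (`integral_signed_sum_le`). This is used twice. It
gives E G² ≤ E ∑ φ(M_j)² ≤ 1, whatever N is. And since 1_A = (1 + s)/2 on the blocks, for A = B^1_1,
it gives 𝓔(H, G) ≥ (1/4) E ∑ M_j (1 - M_j) φ'(M_j). As -∫ LH·G is at most (‖LH‖² + 1)/2, the last
expectation is bounded uniformly in N and φ (`integral_diag_blockMassLaw_le`).

As N → ∞, distinct atoms fall into distinct blocks up to an error of order 1/N, so the bound passes
from the masses M_j to the weights P_i (`lintegral_tsum_rankedWeights_le`). As φ approaches the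
square root, v φ'(v) tends to √v / 2, and Fatou's lemma would make E ∑ √P_i finite
(`exists_lt_lintegral_tsum_rankedWeights`). But power sums do not see the ranking, and E √V_n is a
multiple of 1/n, so this expectation is a divergent harmonic series
(`lintegral_tsum_sqrt_rankedWeights`). -/

theorem lt_descending_iff (v : ℕ → ℝ≥0∞) (k : ℕ) (t : ℝ≥0∞) :
    t < descending v k ↔ ((k + 1 : ℕ) : ℕ∞) ≤ {n | t < v n}.encard := by
  unfold descending
  rw [lt_iSup_iff]
  constructor
  · rintro ⟨⟨A, hA⟩, h⟩
    rw [← hA, ← Set.encard_coe_eq_coe_finsetCard]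
    refine Set.encard_le_encard fun i hi => ?_
    exact h.trans_le (iInf_le (fun i : {i // i ∈ A} => v i.1) ⟨i, hi⟩)
  · intro h
    obtain ⟨s, hs, hc⟩ := Set.exists_subset_encard_eq h
    have hf : s.Finite := Set.finite_of_encard_eq_coe hc
    have hcard : hf.toFinset.card = k + 1 := by
      rw [hf.encard_eq_coe_toFinset_card] at hc
      exact_mod_cast hc
    refine ⟨⟨hf.toFinset, hcard⟩, ?_⟩
    -- An infimum over a finite nonempty set is attained, which keeps the inequality strict.
    have : Nonempty {i // i ∈ hf.toFinset} := by
      obtain ⟨i, hi⟩ := Finset.card_pos.1 (by omega : 0 < hf.toFinset.card)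
      exact ⟨⟨i, hi⟩⟩
    obtain ⟨i, hi⟩ := exists_eq_ciInf_of_finite (f := fun i : {i // i ∈ hf.toFinset} => v i.1)
    rw [← hi]
    exact hs (hf.mem_toFinset.1 i.2)

theorem encard_setOf_natCast_succ_le (c : ℕ∞) : {k : ℕ | ((k + 1 : ℕ) : ℕ∞) ≤ c}.encard = c := by
  induction c using ENat.recTopCoe with
  | top => simp
  | coe n =>
    have : {k : ℕ | ((k + 1 : ℕ) : ℕ∞) ≤ (n : ℕ∞)} = (Finset.range n : Set ℕ) := by
      ext k
      simp only [Nat.cast_le, Set.mem_ofPred_eq, Finset.coe_range, Set.mem_Iio]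
      omega
    rw [this, Set.encard_coe_eq_coe_finsetCard, Finset.card_range]

/-- A sequence and its rearrangement are equimeasurable for counting measure; this is the only
property of `descending` that the proof needs. -/
theorem encard_lt_descending (v : ℕ → ℝ≥0∞) (t : ℝ≥0∞) :
    {k | t < descending v k}.encard = {n | t < v n}.encard := by
  simp only [lt_descending_iff]
  exact encard_setOf_natCast_succ_le _

/-- The layer-cake formula for counting measure: a sum depends only on how many terms exceed each
positive level. -/
theorem tsum_ofReal_congr_of_encard {f g : ℕ → ℝ} (hf : ∀ n, 0 ≤ f n) (hg : ∀ n, 0 ≤ g n)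
    (h : ∀ t, 0 < t → {n | t < f n}.encard = {n | t < g n}.encard) :
    ∑' n, ENNReal.ofReal (f n) = ∑' n, ENNReal.ofReal (g n) := by
  rw [← lintegral_count, ← lintegral_count,
    lintegral_eq_lintegral_meas_lt _ (ae_of_all _ hf) (measurable_of_countable _).aemeasurable,
    lintegral_eq_lintegral_meas_lt _ (ae_of_all _ hg) (measurable_of_countable _).aemeasurable]
  refine setLIntegral_congr_fun measurableSet_Ioi fun t ht => ?_
  rw [Measure.count_apply (Set.to_countable _).measurableSet,
    Measure.count_apply (Set.to_countable _).measurableSet, h t ht]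

/-- Power sums are invariant under descending rearrangement. -/
theorem tsum_rpow_descending {v : ℕ → ℝ≥0∞} (hv : ∀ n, v n ≤ 1) {s : ℝ} (hs : 0 < s) :
    ∑' k, descending v k ^ s = ∑' n, v n ^ s := by
  have hd (k : ℕ) : descending v k ≤ 1 := by
    refine iSup_le fun A => ?_
    obtain ⟨i, hi⟩ := Finset.card_pos.1 (by rw [A.2]; omega : 0 < A.1.card)
    exact (iInf_le (fun i : {i // i ∈ A.1} => v i.1) ⟨i, hi⟩).trans (hv _)
  have e (w : ℕ → ℝ≥0∞) (hw : ∀ n, w n ≤ 1) (n : ℕ) :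
      w n ^ s = ENNReal.ofReal ((w n ^ s).toReal) :=
    (ENNReal.ofReal_toReal (ENNReal.rpow_ne_top_of_nonneg hs.le
      ((hw n).trans_lt ENNReal.one_lt_top).ne)).symm
  rw [tsum_congr (e _ hd), tsum_congr (e _ hv)]
  refine tsum_ofReal_congr_of_encard (fun _ => ENNReal.toReal_nonneg)
    (fun _ => ENNReal.toReal_nonneg) fun t ht => ?_
  have key (w : ℕ → ℝ≥0∞) (hw : ∀ n, w n ≤ 1) :
      {n | t < (w n ^ s).toReal} = {n | ENNReal.ofReal t ^ s⁻¹ < w n} := by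
    ext n
    rw [Set.mem_ofPred_eq, Set.mem_ofPred_eq, ← ENNReal.ofReal_lt_iff_lt_toReal ht.le
      (ENNReal.rpow_ne_top_of_nonneg hs.le ((hw n).trans_lt ENNReal.one_lt_top).ne),
      ENNReal.rpow_inv_lt_iff hs]
  rw [key _ hd, key _ hv, encard_lt_descending]

/-! ### Moments of the stick-breaking weights -/

/-- Weighting a Beta(a, b) density by x^s (1 - x)^t gives a Beta(a + s, b + t) density up to the
ratio of normalizing constants. -/
theorem lintegral_rpow_mul_rpow_betaMeasure {a b s t : ℝ} (ha : 0 < a) (hb : 0 < b) (hs : 0 ≤ s)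
    (ht : 0 ≤ t) :
    ∫⁻ x, ENNReal.ofReal (x ^ s * (1 - x) ^ t) ∂betaMeasure a b =
      ENNReal.ofReal (beta (a + s) (b + t) / beta a b) := by
  have hB := beta_pos ha hb
  have hB' := beta_pos (add_pos_of_pos_of_nonneg ha hs) (add_pos_of_pos_of_nonneg hb ht)
  have hm (a b : ℝ) : Measurable (betaPDF a b) := (measurable_betaPDFReal a b).ennreal_ofReal
  unfold betaMeasure
  rw [lintegral_withDensity_eq_lintegral_mul _ (hm a b) (by fun_prop)]
  have (x : ℝ) : (betaPDF a b * fun x => ENNReal.ofReal (x ^ s * (1 - x) ^ t)) x =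
      ENNReal.ofReal (beta (a + s) (b + t) / beta a b) * betaPDF (a + s) (b + t) x := by
    simp only [Pi.mul_apply, betaPDF, betaPDFReal]
    split_ifs with h
    · have h1 : 0 < 1 - x := by linarith [h.2]
      rw [← ENNReal.ofReal_mul (by have := h.1; positivity), ← ENNReal.ofReal_mul (by positivity)]
      congr 1
      rw [add_sub_right_comm a s 1, add_sub_right_comm b t 1, Real.rpow_add h.1, Real.rpow_add h1]
      field_simp
    · simp
  rw [lintegral_congr this, lintegral_const_mul _ (hm _ _),
    lintegral_betaPDF_eq_one (by linarith) (by linarith), mul_one]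

theorem ae_betaMeasure_mem_Ioo (a b : ℝ) : ∀ᵐ x ∂betaMeasure a b, x ∈ Set.Ioo (0 : ℝ) 1 := by
  have hm : Measurable (betaPDF a b) := (measurable_betaPDFReal a b).ennreal_ofReal
  rw [betaMeasure, ae_withDensity_iff hm]
  refine ae_of_all _ fun x hx => ?_
  by_contra h
  refine hx ?_
  rw [betaPDF, betaPDFReal, if_neg (by exact h), ENNReal.ofReal_zero]

theorem lintegral_infinitePi_prod {ι : Type*} {X : ι → Type*} [∀ i, MeasurableSpace (X i)]
    (μ : ∀ i, Measure (X i)) [∀ i, IsProbabilityMeasure (μ i)] (s : Finset ι)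
    {F : ∀ i, X i → ℝ≥0∞} (hF : ∀ i, Measurable (F i)) :
    ∫⁻ U, ∏ i ∈ s, F i (U i) ∂Measure.infinitePi μ = ∏ i ∈ s, ∫⁻ x, F i x ∂μ i := by
  have h := lintegral_prod_eq_prod_lintegral_of_indepFun s (fun i (U : ∀ i, X i) => F i (U i))
    (iIndepFun_infinitePi (P := μ) hF) (fun i => (hF i).comp (measurable_pi_apply i))
  rw [h]
  refine Finset.prod_congr rfl fun i _ => ?_
  exact (measurePreserving_eval_infinitePi μ i).lintegral_comp (hF i)

/-- The factors in the law of the stick-breaking variables for `α = 1/2` and `θ = 0`. -/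
abbrev halfBeta (n : ℕ) : Measure ℝ := betaMeasure (1 - 1 / 2) (0 + ((n : ℝ) + 1) * (1 / 2))

instance isProbabilityMeasure_halfBeta (n : ℕ) : IsProbabilityMeasure (halfBeta n) :=
  isProbabilityMeasureBeta (by norm_num) (by positivity)

instance isProbabilityMeasure_betaSequenceLaw_half :
    IsProbabilityMeasure (betaSequenceLaw (1 / 2) 0) := by
  have : betaSequenceLaw (1 / 2) 0 = Measure.infinitePi halfBeta := rfl
  rw [this]; infer_instance

theorem ae_betaSequenceLaw_mem_Ioo :
    ∀ᵐ U ∂betaSequenceLaw (1 / 2) 0, ∀ n, U n ∈ Set.Ioo (0 : ℝ) 1 := by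
  rw [ae_all_iff]
  intro n
  have h := measurePreserving_eval_infinitePi halfBeta n
  exact h.quasiMeasurePreserving.ae (ae_betaMeasure_mem_Ioo _ _)

theorem stickBreaking_nonneg {U : ℕ → ℝ} (hU : ∀ n, U n ∈ Set.Ioo (0 : ℝ) 1) (n : ℕ) :
    0 ≤ stickBreaking U n :=
  mul_nonneg (Finset.prod_nonneg fun i _ => sub_nonneg.2 (hU i).2.le) (hU n).1.le

theorem sum_stickBreaking (U : ℕ → ℝ) (m : ℕ) :
    ∑ n ∈ Finset.range m, stickBreaking U n = 1 - ∏ i ∈ Finset.range m, (1 - U i) := by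
  induction m with
  | zero => simp
  | succ m ih =>
    rw [Finset.sum_range_succ, ih, Finset.prod_range_succ, stickBreaking]
    ring

theorem tsum_stickBreaking_le_one {U : ℕ → ℝ} (hU : ∀ n, U n ∈ Set.Ioo (0 : ℝ) 1) :
    ∑' n, ENNReal.ofReal (stickBreaking U n) ≤ 1 := by
  rw [ENNReal.tsum_eq_iSup_nat]
  refine iSup_le fun m => ?_
  rw [← ENNReal.ofReal_sum_of_nonneg fun i _ => stickBreaking_nonneg hU i, sum_stickBreaking,
    ENNReal.ofReal_le_one]
  linarith [Finset.prod_nonneg fun i (_ : i ∈ Finset.range m) => sub_nonneg.2 (hU i).2.le]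

theorem lintegral_stickBreaking_rpow {s : ℝ} (hs : 0 < s) (n : ℕ) :
    ∫⁻ U, ENNReal.ofReal (stickBreaking U n) ^ s ∂betaSequenceLaw (1 / 2) 0 =
      (∏ i ∈ Finset.range n, ENNReal.ofReal
        (beta (1 / 2) (((i : ℝ) + 1) / 2 + s) / beta (1 / 2) (((i : ℝ) + 1) / 2))) *
      ENNReal.ofReal (beta (1 / 2 + s) (((n : ℝ) + 1) / 2) / beta (1 / 2) (((n : ℝ) + 1) / 2)) := by
  -- The zero exponents give every factor the shape x^s (1 - x)^t, so that one beta integral serves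
  -- for all of them.
  set F : ℕ → ℝ → ℝ≥0∞ := fun i x =>
    if i = n then ENNReal.ofReal (x ^ s * (1 - x) ^ (0 : ℝ))
    else ENNReal.ofReal (x ^ (0 : ℝ) * (1 - x) ^ s) with hF
  have hFm (i : ℕ) : Measurable (F i) := by
    simp only [hF]
    split_ifs <;> fun_prop
  have h1 : ∫⁻ U, ENNReal.ofReal (stickBreaking U n) ^ s ∂betaSequenceLaw (1 / 2) 0 =
      ∫⁻ U, ∏ i ∈ Finset.range (n + 1), F i (U i) ∂Measure.infinitePi halfBeta := by
    refine lintegral_congr_ae ?_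
    filter_upwards [ae_betaSequenceLaw_mem_Ioo] with U hU
    rw [ENNReal.ofReal_rpow_of_nonneg (stickBreaking_nonneg hU n) hs.le, Finset.prod_range_succ,
      stickBreaking, Real.mul_rpow
        (Finset.prod_nonneg fun i _ => sub_nonneg.2 (hU i).2.le) (hU n).1.le,
      ← Real.finsetProd_rpow _ _ (fun i _ => sub_nonneg.2 (hU i).2.le),
      ENNReal.ofReal_mul (Finset.prod_nonneg fun i _ =>
        Real.rpow_nonneg (sub_nonneg.2 (hU i).2.le) _),
      ENNReal.ofReal_prod_of_nonneg fun i _ => Real.rpow_nonneg (sub_nonneg.2 (hU i).2.le) _]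
    congr 1
    · refine Finset.prod_congr rfl fun i hi => ?_
      simp [hF, (Finset.mem_range.1 hi).ne]
    · simp [hF]
  have hp (i : ℕ) : 0 + ((i : ℝ) + 1) * (1 / 2) = ((i : ℝ) + 1) / 2 := by ring
  have hq : (1 : ℝ) - 1 / 2 = 1 / 2 := by norm_num
  rw [h1, lintegral_infinitePi_prod _ _ hFm, Finset.prod_range_succ]
  congr 1
  · refine Finset.prod_congr rfl fun i hi => ?_
    simp only [hF, (Finset.mem_range.1 hi).ne, if_false]
    rw [halfBeta, lintegral_rpow_mul_rpow_betaMeasure (by norm_num) (by positivity) le_rfl hs.le,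
      hp, hq, add_zero]
  · simp only [hF, if_true]
    rw [halfBeta, lintegral_rpow_mul_rpow_betaMeasure (by norm_num) (by positivity) hs.le le_rfl,
      hp, hq, add_zero]

/-- The means telescope to total mass 1, which is how the weights are shown to exhaust the stick. -/
theorem lintegral_stickBreaking (n : ℕ) :
    ∫⁻ U, ENNReal.ofReal (stickBreaking U n) ∂betaSequenceLaw (1 / 2) 0 =
      ENNReal.ofReal (1 / ((n : ℝ) + 1) - 1 / ((n : ℝ) + 2)) := by
  have h := lintegral_stickBreaking_rpow one_pos n
  simp only [ENNReal.rpow_one] at h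
  have hG : ∀ x : ℝ, 0 < x → 0 < Real.Gamma x := fun x => Real.Gamma_pos_of_pos
  have h1 (i : ℕ) : beta (1 / 2) (((i : ℝ) + 1) / 2 + 1) / beta (1 / 2) (((i : ℝ) + 1) / 2) =
      ((i : ℝ) + 1) / ((i + 1 : ℕ) + 1) := by
    unfold beta
    rw [show (1 : ℝ) / 2 + (((i : ℝ) + 1) / 2 + 1) = (1 / 2 + ((i : ℝ) + 1) / 2) + 1 by ring,
      Real.Gamma_add_one (by positivity), Real.Gamma_add_one (by positivity)]
    have := (hG (1 / 2) (by norm_num)).ne'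
    have := (hG (((i : ℝ) + 1) / 2) (by positivity)).ne'
    have := (hG (1 / 2 + ((i : ℝ) + 1) / 2) (by positivity)).ne'
    push_cast
    field_simp
    ring
  have h2 : beta (1 / 2 + 1) (((n : ℝ) + 1) / 2) / beta (1 / 2) (((n : ℝ) + 1) / 2) =
      1 / ((n : ℝ) + 2) := by
    unfold beta
    rw [show (1 : ℝ) / 2 + 1 + ((n : ℝ) + 1) / 2 = (1 / 2 + ((n : ℝ) + 1) / 2) + 1 by ring,
      Real.Gamma_add_one (by positivity), Real.Gamma_add_one (by positivity)]
    have := (hG (1 / 2) (by norm_num)).ne'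
    have := (hG (((n : ℝ) + 1) / 2) (by positivity)).ne'
    have := (hG (1 / 2 + ((n : ℝ) + 1) / 2) (by positivity)).ne'
    field_simp
    ring
  have h3 (m : ℕ) : ∏ i ∈ Finset.range m, ((i : ℝ) + 1) / ((i + 1 : ℕ) + 1) = 1 / ((m : ℝ) + 1) := by
    induction m with
    | zero => simp
    | succ m ih =>
      rw [Finset.prod_range_succ, ih]
      field_simp
  rw [h, ← ENNReal.ofReal_prod_of_nonneg fun i _ => by rw [h1]; positivity,
    Finset.prod_congr rfl fun i _ => h1 i, h2, h3, ← ENNReal.ofReal_mul (by positivity)]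
  congr 1
  field_simp
  ring

/-- The Gamma quotients telescope through `ρ`, the last factor cancels `ρ n`, and 1 / Γ(1/2)² = 1 /
π remains. The outcome is a harmonic term. -/
theorem lintegral_sqrt_stickBreaking (n : ℕ) :
    ∫⁻ U, ENNReal.ofReal (stickBreaking U n) ^ (1 / 2 : ℝ) ∂betaSequenceLaw (1 / 2) 0 =
      ENNReal.ofReal (2 / Real.pi * (1 / ((n : ℝ) + 1))) := by
  rw [lintegral_stickBreaking_rpow (by norm_num)]
  have hG : ∀ x : ℝ, 0 < x → 0 < Real.Gamma x := fun x => Real.Gamma_pos_of_pos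
  set ρ : ℕ → ℝ := fun i => Real.Gamma (((i : ℝ) + 2) / 2) / Real.Gamma (((i : ℝ) + 1) / 2) with hρ
  have hρpos (i : ℕ) : 0 < ρ i := div_pos (hG _ (by positivity)) (hG _ (by positivity))
  have h1 (i : ℕ) : beta (1 / 2) (((i : ℝ) + 1) / 2 + 1 / 2) / beta (1 / 2) (((i : ℝ) + 1) / 2) =
      ρ i / ρ (i + 1) := by
    simp only [beta, hρ]
    push_cast
    rw [show (1 : ℝ) / 2 + (((i : ℝ) + 1) / 2 + 1 / 2) = ((i : ℝ) + 1 + 2) / 2 by ring,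
      show (1 : ℝ) / 2 + ((i : ℝ) + 1) / 2 = ((i : ℝ) + 2) / 2 by ring,
      show ((i : ℝ) + 1) / 2 + 1 / 2 = ((i : ℝ) + 2) / 2 by ring,
      show ((i : ℝ) + 1 + 1) / 2 = ((i : ℝ) + 2) / 2 by ring]
    have := (hG (1 / 2) (by norm_num)).ne'
    have := (hG (((i : ℝ) + 1) / 2) (by positivity)).ne'
    have := (hG (((i : ℝ) + 2) / 2) (by positivity)).ne'
    have := (hG (((i : ℝ) + 1 + 2) / 2) (by positivity)).ne'
    field_simp
  have h2 : beta (1 / 2 + 1 / 2) (((n : ℝ) + 1) / 2) / beta (1 / 2) (((n : ℝ) + 1) / 2) =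
      2 / ((n : ℝ) + 1) / Real.Gamma (1 / 2) * ρ n := by
    simp only [beta, hρ]
    rw [show (1 : ℝ) / 2 + 1 / 2 = 1 by ring, Real.Gamma_one,
      show (1 : ℝ) + ((n : ℝ) + 1) / 2 = ((n : ℝ) + 1) / 2 + 1 by ring,
      Real.Gamma_add_one (by positivity),
      show (1 : ℝ) / 2 + ((n : ℝ) + 1) / 2 = ((n : ℝ) + 2) / 2 by ring]
    have := (hG (1 / 2) (by norm_num)).ne'
    have := (hG (((n : ℝ) + 1) / 2) (by positivity)).ne'
    have := (hG (((n : ℝ) + 2) / 2) (by positivity)).ne'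
    field_simp
  have h3 (m : ℕ) : ∏ i ∈ Finset.range m, ρ i / ρ (i + 1) = ρ 0 / ρ m := by
    induction m with
    | zero => simp [(hρpos 0).ne']
    | succ m ih =>
      rw [Finset.prod_range_succ, ih]
      have := (hρpos m).ne'
      field_simp
  have h0 : ρ 0 = 1 / Real.Gamma (1 / 2) := by simp [hρ]
  rw [← ENNReal.ofReal_prod_of_nonneg fun i _ => by
      rw [h1]; exact (div_pos (hρpos _) (hρpos _)).le,
    Finset.prod_congr rfl fun i _ => h1 i, h2, h3,
    ← ENNReal.ofReal_mul (div_pos (hρpos _) (hρpos _)).le, h0]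
  congr 1
  have := (hρpos n).ne'
  have h4 : Real.Gamma (1 / 2) ^ 2 = Real.pi := by
    rw [Real.Gamma_one_half_eq, Real.sq_sqrt Real.pi_pos.le]
  have := (hG (1 / 2) (by norm_num)).ne'
  rw [← h4]
  field_simp

theorem measurable_stickBreaking (n : ℕ) : Measurable fun U : ℕ → ℝ => stickBreaking U n := by
  unfold stickBreaking
  fun_prop

/-! ### The ranked weights -/

theorem tsum_rankedWeights_rpow {U : ℕ → ℝ} (hU : ∀ n, U n ∈ Set.Ioo (0 : ℝ) 1) {s : ℝ}
    (hs : 0 < s) :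
    ∑' k, rankedWeights U k ^ s = ∑' n, ENNReal.ofReal (stickBreaking U n) ^ s :=
  tsum_rpow_descending (fun n => (ENNReal.le_tsum n).trans (tsum_stickBreaking_le_one hU)) hs

theorem ae_tsum_rankedWeights :
    ∀ᵐ U ∂betaSequenceLaw (1 / 2) 0, ∑' k, rankedWeights U k = 1 := by
  have hm : Measurable fun U : ℕ → ℝ => ∑' n, ENNReal.ofReal (stickBreaking U n) :=
    Measurable.tsum fun n => (measurable_stickBreaking n).ennreal_ofReal
  have hle : (fun U : ℕ → ℝ => ∑' n, ENNReal.ofReal (stickBreaking U n))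
      ≤ᵐ[betaSequenceLaw (1 / 2) 0] fun _ => 1 := by
    filter_upwards [ae_betaSequenceLaw_mem_Ioo] with U hU using tsum_stickBreaking_le_one hU
  have hint : ∫⁻ U, ∑' n, ENNReal.ofReal (stickBreaking U n) ∂betaSequenceLaw (1 / 2) 0 = 1 := by
    rw [lintegral_tsum fun n => (measurable_stickBreaking n).ennreal_ofReal.aemeasurable]
    simp only [lintegral_stickBreaking]
    have hnn (n : ℕ) : 0 ≤ 1 / ((n : ℝ) + 1) - 1 / ((n : ℝ) + 2) := by
      rw [sub_nonneg]
      exact one_div_le_one_div_of_le (by positivity) (by linarith)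
    have hs : HasSum (fun n : ℕ => 1 / ((n : ℝ) + 1) - 1 / ((n : ℝ) + 2)) 1 := by
      rw [hasSum_iff_tendsto_nat_of_nonneg hnn]
      have (m : ℕ) : ∑ n ∈ Finset.range m, (1 / ((n : ℝ) + 1) - 1 / ((n : ℝ) + 2)) =
          1 - 1 / ((m : ℝ) + 1) := by
        induction m with
        | zero => simp
        | succ m ih =>
          rw [Finset.sum_range_succ, ih]
          push_cast
          ring
      simp only [this]
      simpa using tendsto_one_div_add_atTop_nhds_zero_nat (𝕜 := ℝ) |>.const_sub 1
    rw [← ENNReal.ofReal_tsum_of_nonneg hnn hs.summable, hs.tsum_eq, ENNReal.ofReal_one]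
  -- A variable that is at most 1 and has mean 1 equals 1 almost surely.
  have h := ae_eq_of_ae_le_of_lintegral_le hle (by rw [hint]; simp) aemeasurable_const
    (by rw [hint, lintegral_one, measure_univ])
  filter_upwards [h, ae_betaSequenceLaw_mem_Ioo] with U h1 hU
  have := tsum_rankedWeights_rpow hU one_pos
  simp only [ENNReal.rpow_one] at this
  rw [this, h1]

theorem lintegral_tsum_sqrt_rankedWeights :
    ∫⁻ U, ∑' k, rankedWeights U k ^ (1 / 2 : ℝ) ∂betaSequenceLaw (1 / 2) 0 = ⊤ := by
  have h : ∫⁻ U, ∑' k, rankedWeights U k ^ (1 / 2 : ℝ) ∂betaSequenceLaw (1 / 2) 0 =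
      ∫⁻ U, ∑' n, ENNReal.ofReal (stickBreaking U n) ^ (1 / 2 : ℝ) ∂betaSequenceLaw (1 / 2) 0 := by
    refine lintegral_congr_ae ?_
    filter_upwards [ae_betaSequenceLaw_mem_Ioo] with U hU
    exact tsum_rankedWeights_rpow hU (by norm_num)
  rw [h, lintegral_tsum fun n =>
    ((measurable_stickBreaking n).ennreal_ofReal.pow_const _).aemeasurable]
  simp only [lintegral_sqrt_stickBreaking]
  by_contra hne
  have hs : Summable fun n : ℕ => 2 / Real.pi * (1 / ((n : ℝ) + 1)) := by
    have := ENNReal.summable_toReal hne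
    refine this.congr fun n => ENNReal.toReal_ofReal (by positivity)
  rw [summable_mul_left_iff (by positivity)] at hs
  refine Real.not_summable_one_div_natCast ?_
  rw [← summable_nat_add_iff 1]
  exact_mod_cast hs

/-! ### A smooth approximation of the square root -/

/-- The smooth function `v ↦ (v² + ε²)^{1/4} - ε^{1/2}`, which approximates `√v` for `v ≥ 0`. -/
def smoothSqrt (ε v : ℝ) : ℝ := √(√(v ^ 2 + ε ^ 2)) - √ε

/-- The derivative of `smoothSqrt ε`. -/
def smoothSqrtDeriv (ε v : ℝ) : ℝ := v / (2 * √(v ^ 2 + ε ^ 2) * √(√(v ^ 2 + ε ^ 2)))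

theorem contDiff_smoothSqrt {ε : ℝ} (hε : 0 < ε) : ContDiff ℝ ∞ (smoothSqrt ε) := by
  unfold smoothSqrt
  refine ContDiff.sub (ContDiff.sqrt (ContDiff.sqrt (by fun_prop) fun v => ?_) fun v => ?_)
    contDiff_const <;> positivity

theorem contDiff_smoothSqrtDeriv {ε : ℝ} (hε : 0 < ε) : ContDiff ℝ ∞ (smoothSqrtDeriv ε) := by
  unfold smoothSqrtDeriv
  have h : ContDiff ℝ ∞ fun v : ℝ => √(v ^ 2 + ε ^ 2) :=
    ContDiff.sqrt (by fun_prop) fun v => by positivity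
  refine contDiff_id.div ((contDiff_const.mul h).mul (h.sqrt fun v => ?_)) fun v => ?_ <;>
    positivity

theorem hasDerivAt_smoothSqrt {ε : ℝ} (hε : 0 < ε) (v : ℝ) :
    HasDerivAt (smoothSqrt ε) (smoothSqrtDeriv ε v) v := by
  have h1 : HasDerivAt (fun v : ℝ => v ^ 2 + ε ^ 2) (2 * v) v := by
    simpa using (hasDerivAt_pow 2 v).add_const (ε ^ 2)
  have h2 := ((h1.sqrt (by positivity)).sqrt (by positivity)).sub_const √ε
  refine h2.congr_deriv ?_
  unfold smoothSqrtDeriv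
  have : 0 < √(v ^ 2 + ε ^ 2) := by positivity
  field_simp

theorem smoothSqrt_nonneg (ε v : ℝ) : 0 ≤ smoothSqrt ε v := by
  unfold smoothSqrt
  refine sub_nonneg.2 (Real.sqrt_le_sqrt (Real.le_sqrt_of_sq_le ?_))
  nlinarith [sq_nonneg v]

/-- Subtracting √ε in `smoothSqrt` serves this bound: (φ + √ε)² = √(v² + ε²) ≤ v + ε, and the two
terms ε cancel. -/
theorem smoothSqrt_sq_le {ε v : ℝ} (hε : 0 < ε) (hv : 0 ≤ v) : smoothSqrt ε v ^ 2 ≤ v := by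
  have h0 := smoothSqrt_nonneg ε v
  have h1 : √(v ^ 2 + ε ^ 2) ≤ v + ε := by
    refine Real.sqrt_le_iff.2 ⟨by positivity, by nlinarith⟩
  have h2 : √(√(v ^ 2 + ε ^ 2)) = smoothSqrt ε v + √ε := by unfold smoothSqrt; ring
  have h3 : √(√(v ^ 2 + ε ^ 2)) ^ 2 = √(v ^ 2 + ε ^ 2) := Real.sq_sqrt (by positivity)
  have h4 : √ε ^ 2 = ε := Real.sq_sqrt hε.le
  rw [h2] at h3
  nlinarith [Real.sqrt_nonneg ε, mul_nonneg h0 (Real.sqrt_nonneg ε)]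

theorem smoothSqrtDeriv_nonneg (ε : ℝ) {v : ℝ} (hv : 0 ≤ v) : 0 ≤ smoothSqrtDeriv ε v := by
  unfold smoothSqrtDeriv
  positivity

theorem tendsto_smoothSqrtDeriv {v : ℝ} (hv : 0 < v) :
    Filter.Tendsto (fun n : ℕ => smoothSqrtDeriv (1 / ((n : ℝ) + 1)) v) Filter.atTop
      (nhds (1 / (2 * √v))) := by
  -- For fixed v > 0 the formula stays continuous at ε = 0, where it is the derivative of the true
  -- square root.
  have h : ContinuousAt (fun ε : ℝ => smoothSqrtDeriv ε v) 0 := by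
    unfold smoothSqrtDeriv
    refine ContinuousAt.div (by fun_prop) (by fun_prop) ?_
    have : 0 < v ^ 2 + (0 : ℝ) ^ 2 := by positivity
    positivity
  have h0 : smoothSqrtDeriv 0 v = 1 / (2 * √v) := by
    unfold smoothSqrtDeriv
    rw [zero_pow two_ne_zero, add_zero, Real.sqrt_sq hv.le]
    have : 0 < √v := Real.sqrt_pos.2 hv
    field_simp
  rw [← h0]
  exact h.tendsto.comp (tendsto_one_div_add_atTop_nhds_zero_nat (𝕜 := ℝ))

/-! ### Exchangeable laws on the simplex -/

/-- A probability measure on the simplex that is invariant under permutations of coordinates. -/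
structure IsExchangeableOnSimplex {ι : Type*} [Fintype ι] (Λ : Measure (ι → ℝ)) : Prop where
  isProbabilityMeasure : IsProbabilityMeasure Λ
  map_perm : ∀ σ : Equiv.Perm ι, Λ.map (fun x i => x (σ i)) = Λ
  ae_nonneg : ∀ᵐ x ∂Λ, ∀ i, 0 ≤ x i
  ae_sum : ∀ᵐ x ∂Λ, ∑ i, x i = 1

namespace IsExchangeableOnSimplex

variable {ι : Type*} [Fintype ι] {Λ : Measure (ι → ℝ)}

theorem ae_mem_Icc (hΛ : IsExchangeableOnSimplex Λ) : ∀ᵐ x ∂Λ, ∀ i, x i ∈ Set.Icc (0 : ℝ) 1 := by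
  filter_upwards [hΛ.ae_nonneg, hΛ.ae_sum] with x h0 h1 i
  exact ⟨h0 i, h1 ▸ Finset.single_le_sum (fun j _ => h0 j) (Finset.mem_univ i)⟩

theorem integrable_of_continuous (hΛ : IsExchangeableOnSimplex Λ) {f : (ι → ℝ) → ℝ}
    (hf : Continuous f) : Integrable f Λ := by
  have := hΛ.isProbabilityMeasure
  have hc : IsCompact (Set.pi Set.univ fun _ : ι => Set.Icc (0 : ℝ) 1) :=
    isCompact_univ_pi fun _ => isCompact_Icc
  obtain ⟨C, hC⟩ := hc.exists_bound_of_continuousOn hf.continuousOn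
  refine Integrable.of_bound hf.aestronglyMeasurable C ?_
  filter_upwards [hΛ.ae_mem_Icc] with x hx
  exact hC x fun i _ => hx i

theorem integral_pair_eq (hΛ : IsExchangeableOnSimplex Λ) {h : ℝ → ℝ → ℝ}
    (hh : Continuous fun p : ℝ × ℝ => h p.1 p.2) {i j i' j' : ι} (hij : i ≠ j) (hij' : i' ≠ j') :
    ∫ x, h (x i) (x j) ∂Λ = ∫ x, h (x i') (x j') ∂Λ := by
  classical
  -- The first swap sends i to i'; the second corrects the image of j and leaves i' fixed, since i'
  -- is neither that image nor j'.
  set σ : Equiv.Perm ι := Equiv.swap (Equiv.swap i i' j) j' * Equiv.swap i i' with hσ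
  have hi : σ i = i' := by
    have h1 : i' ≠ Equiv.swap i i' j := fun h2 => hij (by
      exact (Equiv.swap i i').injective ((Equiv.swap_apply_left i i').trans h2))
    rw [hσ, Equiv.Perm.mul_apply, Equiv.swap_apply_left, Equiv.swap_apply_of_ne_of_ne h1 hij']
  have hj : σ j = j' := by
    rw [hσ, Equiv.Perm.mul_apply, Equiv.swap_apply_left]
  have hcont : Continuous fun x : ι → ℝ => h (x i) (x j) :=
    hh.comp (by fun_prop : Continuous fun x : ι → ℝ => (x i, x j))
  calc ∫ x, h (x i) (x j) ∂Λ = ∫ x, h (x i) (x j) ∂Λ.map (fun x i => x (σ i)) := by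
        rw [hΛ.map_perm σ]
    _ = ∫ x, h (x i') (x j') ∂Λ := by
        rw [integral_map (measurable_pi_lambda _ fun i => measurable_pi_apply (σ i)).aemeasurable
          hcont.aestronglyMeasurable]
        simp only [hi, hj]

/-- Off-diagonal terms of a balanced signed double sum have a nonpositive total expectation. -/
theorem integral_signed_sum_le (hΛ : IsExchangeableOnSimplex Λ) {s : ι → ℝ}
    (hs : ∀ i, s i * s i = 1) (hs0 : ∑ i, s i = 0) {h : ℝ → ℝ → ℝ}
    (hh : Continuous fun p : ℝ × ℝ => h p.1 p.2) (hpos : ∀ u v, 0 ≤ u → 0 ≤ v → 0 ≤ h u v) :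
    ∫ x, ∑ i, ∑ j, s i * s j * h (x i) (x j) ∂Λ ≤ ∫ x, ∑ i, h (x i) (x i) ∂Λ := by
  classical
  have hcont (i j : ι) : Continuous fun x : ι → ℝ => h (x i) (x j) :=
    hh.comp (by fun_prop : Continuous fun x : ι → ℝ => (x i, x j))
  have hint (i j : ι) : Integrable (fun x : ι → ℝ => h (x i) (x j)) Λ :=
    hΛ.integrable_of_continuous (hcont i j)
  -- By exchangeability all off-diagonal expectations share one value b ≥ 0. As ∑ s = 0, the
  -- off-diagonal signs add up to -∑ s_i² = -card ι, so these terms contribute -b · card ι.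
  obtain ⟨b, hb0, hb⟩ : ∃ b : ℝ, 0 ≤ b ∧ ∀ i j, i ≠ j → ∫ x, h (x i) (x j) ∂Λ = b := by
    by_cases hne : ∃ i j : ι, i ≠ j
    · obtain ⟨i, j, hij⟩ := hne
      refine ⟨_, ?_, fun i' j' hij' => hΛ.integral_pair_eq hh hij' hij⟩
      refine integral_nonneg_of_ae ?_
      filter_upwards [hΛ.ae_nonneg] with x hx using hpos _ _ (hx i) (hx j)
    · push Not at hne
      exact ⟨0, le_rfl, fun i j hij => absurd (hne i j) hij⟩
  rw [integral_finsetSum _ fun i _ => integrable_finsetSum _ fun j _ => (hint i j).const_mul _,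
    integral_finsetSum _ fun i _ => hint i i]
  have e (i : ι) : ∫ x, ∑ j, s i * s j * h (x i) (x j) ∂Λ =
      s i * b * ∑ j, s j + (∫ x, h (x i) (x i) ∂Λ - b) := by
    rw [integral_finsetSum _ fun j _ => (hint i j).const_mul _]
    simp only [integral_const_mul]
    have (j : ι) : s i * s j * ∫ x, h (x i) (x j) ∂Λ =
        s i * b * s j + if j = i then ∫ x, h (x i) (x i) ∂Λ - b else 0 := by
      split_ifs with hji
      · subst hji
        linear_combination (∫ x, h (x j) (x j) ∂Λ - b) * hs j
      · rw [hb i j (Ne.symm hji)]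
        ring
    rw [Finset.sum_congr rfl fun j _ => this j, Finset.sum_add_distrib, ← Finset.mul_sum,
      Finset.sum_ite_eq' Finset.univ i, if_pos (Finset.mem_univ i)]
  rw [Finset.sum_congr rfl fun i _ => e i, hs0]
  refine Finset.sum_le_sum fun i _ => ?_
  linarith

/-- Expanding the square, the cross terms can only lower the mean, and the diagonal is at most ∑ x_i
= 1. -/
theorem integral_sq_signed_sum_le (hΛ : IsExchangeableOnSimplex Λ) {s : ι → ℝ}
    (hs : ∀ i, s i * s i = 1) (hs0 : ∑ i, s i = 0) {φ : ℝ → ℝ} (hφ : Continuous φ)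
    (hφ0 : ∀ v, 0 ≤ φ v) (hφ2 : ∀ v, 0 ≤ v → φ v ^ 2 ≤ v) :
    ∫ x, (∑ i, s i * φ (x i)) ^ 2 ∂Λ ≤ 1 := by
  have := hΛ.isProbabilityMeasure
  have h1 := hΛ.integral_signed_sum_le hs hs0 (h := fun u v => φ u * φ v) (by fun_prop)
    fun u v _ _ => mul_nonneg (hφ0 u) (hφ0 v)
  have h2 (x : ι → ℝ) : (∑ i, s i * φ (x i)) ^ 2 =
      ∑ i, ∑ j, s i * s j * (φ (x i) * φ (x j)) := by
    rw [sq, Finset.sum_mul_sum]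
    refine Finset.sum_congr rfl fun i _ => Finset.sum_congr rfl fun j _ => by ring
  have h3 : ∫ x, ∑ i, φ (x i) * φ (x i) ∂Λ ≤ ∫ _, (1 : ℝ) ∂Λ := by
    refine integral_mono_ae (hΛ.integrable_of_continuous (by fun_prop)) (integrable_const _) ?_
    filter_upwards [hΛ.ae_nonneg, hΛ.ae_sum] with x hx0 hx1
    rw [← hx1]
    exact Finset.sum_le_sum fun i _ => by simpa [sq] using hφ2 (x i) (hx0 i)
  simp only [h2]
  refine h1.trans (h3.trans ?_)
  simp

/-- The signed double sum is at most its diagonal ∑ x_i² ψ(x_i) in mean; subtracting this from ∑ x_i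
ψ(x_i) leaves the factor 1 - x_i. -/
theorem integral_diag_le (hΛ : IsExchangeableOnSimplex Λ) {s : ι → ℝ}
    (hs : ∀ i, s i * s i = 1) (hs0 : ∑ i, s i = 0) {ψ : ℝ → ℝ} (hψ : Continuous ψ)
    (hψ0 : ∀ v, 0 ≤ v → 0 ≤ ψ v) :
    ∫ x, ∑ i, x i * ((1 - x i) * ψ (x i)) ∂Λ ≤
      ∫ x, (∑ i, x i * ψ (x i) - ∑ i, ∑ j, s i * s j * (x i * (x j * ψ (x j)))) ∂Λ := by
  have h1 := hΛ.integral_signed_sum_le hs hs0 (h := fun u v => u * (v * ψ v)) (by fun_prop)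
    fun u v hu hv => mul_nonneg hu (mul_nonneg hv (hψ0 v hv))
  rw [integral_sub (hΛ.integrable_of_continuous (by fun_prop))
    (hΛ.integrable_of_continuous (by fun_prop))]
  have h2 : ∫ x, ∑ i, x i * ((1 - x i) * ψ (x i)) ∂Λ =
      ∫ x, ∑ i, x i * ψ (x i) ∂Λ - ∫ x, ∑ i, x i * (x i * ψ (x i)) ∂Λ := by
    rw [← integral_sub (hΛ.integrable_of_continuous (by fun_prop))
      (hΛ.integrable_of_continuous (by fun_prop))]
    refine integral_congr_ae (ae_of_all _ fun x => ?_)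
    simp only [← Finset.sum_sub_distrib]
    exact Finset.sum_congr rfl fun i _ => by ring
  linarith

end IsExchangeableOnSimplex

/-! ### Masses of blocks that are labelled independently and uniformly -/

theorem infinitePi_eval_eq_eval {ι : Type*} [Fintype ι] [MeasurableSpace ι]
    [MeasurableSingletonClass ι] {κ : Measure ι} [IsProbabilityMeasure κ]
    (hκ : ∀ j, κ {j} = (Fintype.card ι : ℝ≥0∞)⁻¹) {k i : ℕ} (hki : k ≠ i) :
    Measure.infinitePi (fun _ : ℕ => κ) {ℓ | ℓ k = ℓ i} = (Fintype.card ι : ℝ≥0∞)⁻¹ := by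
  have hm : MeasurableSet {p : ι × ι | p.1 = p.2} := measurableSet_eq_fun measurable_fst measurable_snd
  have h := Measure.infinitePi_map_eval_prod (P := fun _ : ℕ => κ) hki
  have e : Measure.infinitePi (fun _ : ℕ => κ) {ℓ | ℓ k = ℓ i} =
      (Measure.infinitePi fun _ : ℕ => κ).map (fun ℓ => (ℓ k, ℓ i)) {p : ι × ι | p.1 = p.2} := by
    rw [Measure.map_apply (by fun_prop) hm]
    rfl
  rw [e, h, Measure.prod_apply hm]
  have (x : ι) : Prod.mk x ⁻¹' {p : ι × ι | p.1 = p.2} = {x} := by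
    ext y
    simp [eq_comm]
  simp only [this, hκ]
  simp

section blockMass

variable {ι : Type*} [DecidableEq ι]

/-- The mass of the block `j` if the atom `i` has the weight `w i` and lies in the block `ℓ i`. -/
def blockMass (w : ℕ → ℝ≥0∞) (ℓ : ℕ → ι) (j : ι) : ℝ≥0∞ := ∑' i, if ℓ i = j then w i else 0

theorem blockMass_self (w : ℕ → ℝ≥0∞) (ℓ : ℕ → ι) (i : ℕ) :
    blockMass w ℓ (ℓ i) = w i + ∑' k, if k ≠ i ∧ ℓ k = ℓ i then w k else 0 := by
  rw [blockMass, ENNReal.tsum_eq_add_tsum_ite i]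
  simp only [if_true]
  congr 1
  refine tsum_congr fun k => ?_
  by_cases h : k = i <;> simp [h]

theorem measurable_blockMass {Ω : Type*} [MeasurableSpace Ω] [MeasurableSpace ι] [MeasurableSingletonClass ι]
    {w : Ω → ℕ → ℝ≥0∞} {ℓ : Ω → ℕ → ι}
    (hw : ∀ i, Measurable fun p => w p i) (hℓ : ∀ i, Measurable fun p => ℓ p i) (j : ι) :
    Measurable fun p => blockMass (w p) (ℓ p) j :=
  Measurable.tsum fun i =>
    Measurable.ite (hℓ i (measurableSet_singleton j)) (hw i) measurable_const

theorem measurable_blockMass_rankedWeights [MeasurableSpace ι]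
    [MeasurableSingletonClass ι] (j : ι) : Measurable fun p : (ℕ → ℝ) × (ℕ → ι) =>
    blockMass (rankedWeights p.1) p.2 j :=
  measurable_blockMass (w := fun p : (ℕ → ℝ) × (ℕ → ι) => rankedWeights p.1)
    (ℓ := fun p : (ℕ → ℝ) × (ℕ → ι) => p.2)
    (fun i => (measurable_rankedWeights i).comp measurable_fst)
    (fun i => (measurable_pi_apply i).comp measurable_snd) j

theorem measurable_toReal_blockMass [MeasurableSpace ι] [MeasurableSingletonClass ι] :
    Measurable fun (p : (ℕ → ℝ) × (ℕ → ι)) (j : ι) =>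
    (blockMass (rankedWeights p.1) p.2 j).toReal :=
  measurable_pi_lambda _ fun j => (measurable_blockMass_rankedWeights j).ennreal_toReal

variable [Fintype ι]

/-- A sum over blocks weighted by mass is a sum over atoms, each seeing the value of its own block.
This is what allows blocks and atoms to be compared term by term. -/
theorem sum_blockMass_mul (w : ℕ → ℝ≥0∞) (ℓ : ℕ → ι) (f : ι → ℝ≥0∞) :
    ∑ j, blockMass w ℓ j * f j = ∑' i, w i * f (ℓ i) := by
  simp only [blockMass, ← ENNReal.tsum_mul_right]
  rw [← Summable.tsum_finsetSum fun _ _ => ENNReal.summable]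
  refine tsum_congr fun i => ?_
  simp

theorem sum_blockMass (w : ℕ → ℝ≥0∞) (ℓ : ℕ → ι) : ∑ j, blockMass w ℓ j = ∑' i, w i := by
  simpa using sum_blockMass_mul w ℓ fun _ => 1

theorem blockMass_le_one {w : ℕ → ℝ≥0∞} (hw : ∑' i, w i = 1) (ℓ : ℕ → ι) (j : ι) :
    blockMass w ℓ j ≤ 1 := by
  rw [← hw, ← sum_blockMass w ℓ]
  exact Finset.single_le_sum (fun _ _ => zero_le) (Finset.mem_univ j)

variable [MeasurableSpace ι] [MeasurableSingletonClass ι]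

/-- The law of the block masses for ranked weights and i.i.d. labels with law `κ`. -/
def blockMassLaw (κ : Measure ι) : Measure (ι → ℝ) :=
  ((betaSequenceLaw (1 / 2) 0).prod (Measure.infinitePi fun _ : ℕ => κ)).map
    fun p j => (blockMass (rankedWeights p.1) p.2 j).toReal

theorem ae_prod_tsum_rankedWeights {X : Type*} [MeasurableSpace X] (m : Measure X) [SFinite m] :
    ∀ᵐ p ∂(betaSequenceLaw (1 / 2) 0).prod m, ∑' i, rankedWeights p.1 i = 1 :=
  Measure.quasiMeasurePreserving_fst.ae ae_tsum_rankedWeights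

theorem isExchangeableOnSimplex_blockMassLaw {κ : Measure ι} [IsProbabilityMeasure κ]
    (hκ : ∀ j, κ {j} = (Fintype.card ι : ℝ≥0∞)⁻¹) :
    IsExchangeableOnSimplex (blockMassLaw κ) where
  isProbabilityMeasure := Measure.isProbabilityMeasure_map measurable_toReal_blockMass.aemeasurable
  map_perm σ := by
    -- The uniform law is invariant under relabelling, hence so is the law of the i.i.d. labels;
    -- permuting the blocks amounts to relabelling the atoms.
    have hσ : κ.map σ.symm = κ := by
      refine Measure.ext_of_singleton fun j => ?_
      rw [Measure.map_apply (measurable_of_finite _) (measurableSet_singleton j), hκ,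
        ← Equiv.image_eq_preimage_symm]
      simp [hκ]
    have hp : Measure.infinitePi (fun _ : ℕ => κ) =
        (Measure.infinitePi fun _ : ℕ => κ).map fun ℓ i => σ.symm (ℓ i) := by
      rw [Measure.infinitePi_map_pi _ fun _ => measurable_of_finite _]
      simp only [hσ]
    have hmσ : Measurable fun (ℓ : ℕ → ι) i => σ.symm (ℓ i) :=
      measurable_pi_lambda _ fun i => (measurable_of_finite σ.symm).comp (measurable_pi_apply i)
    have hmap : ((betaSequenceLaw (1 / 2) 0).prod (Measure.infinitePi fun _ : ℕ => κ)) =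
        ((betaSequenceLaw (1 / 2) 0).prod (Measure.infinitePi fun _ : ℕ => κ)).map
          (Prod.map id fun ℓ i => σ.symm (ℓ i)) := by
      have h := Measure.map_prod_map (betaSequenceLaw (1 / 2) 0)
        (Measure.infinitePi fun _ : ℕ => κ) measurable_id hmσ
      rwa [← hp, Measure.map_id] at h
    have hm : Measurable (Prod.map id fun (ℓ : ℕ → ι) i => σ.symm (ℓ i) :
        (ℕ → ℝ) × (ℕ → ι) → (ℕ → ℝ) × (ℕ → ι)) :=
      measurable_id.prodMap hmσ
    conv_rhs => rw [blockMassLaw, hmap, Measure.map_map measurable_toReal_blockMass hm]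
    rw [blockMassLaw, Measure.map_map (by fun_prop) measurable_toReal_blockMass]
    congr 1
    funext p j
    simp only [Function.comp_apply, Prod.map_fst, Prod.map_snd, id, blockMass,
      Equiv.symm_apply_eq]
  ae_nonneg := by
    rw [blockMassLaw, ae_map_iff measurable_toReal_blockMass.aemeasurable (by measurability)]
    exact ae_of_all _ fun p i => ENNReal.toReal_nonneg
  ae_sum := by
    rw [blockMassLaw, ae_map_iff measurable_toReal_blockMass.aemeasurable (by measurability)]
    filter_upwards [ae_prod_tsum_rankedWeights (Measure.infinitePi fun _ : ℕ => κ)] with p hp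
    rw [← ENNReal.toReal_sum fun j _ =>
      ((blockMass_le_one hp p.2 j).trans_lt ENNReal.one_lt_top).ne, sum_blockMass, hp,
      ENNReal.toReal_one]

/-- Up to an error of order `1 / card ι`, atoms do not share blocks. -/
theorem lintegral_tsum_rankedWeights_le {κ : Measure ι} [IsProbabilityMeasure κ]
    (hκ : ∀ j, κ {j} = (Fintype.card ι : ℝ≥0∞)⁻¹) {g : ℝ → ℝ} (hg : Measurable g) {K : NNReal}
    (hK : LipschitzOnWith K g (Set.Icc 0 1)) :
    ∫⁻ U, ∑' i, rankedWeights U i * ENNReal.ofReal (g (rankedWeights U i).toReal)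
        ∂betaSequenceLaw (1 / 2) 0 ≤
      ∫⁻ x, ∑ j, ENNReal.ofReal (x j) * ENNReal.ofReal (g (x j)) ∂blockMassLaw κ +
        K * (Fintype.card ι : ℝ≥0∞)⁻¹ := by
  set Q := (betaSequenceLaw (1 / 2) 0).prod (Measure.infinitePi fun _ : ℕ => κ) with hQ
  -- `D` weighs, for each atom, the mass of the other atoms in its block. Two labels agree with
  -- probability 1 / card ι and the weights add up to 1, so the mean of `D` is at most 1 / card ι.
  set D : (ℕ → ℝ) × (ℕ → ι) → ℝ≥0∞ := fun p =>
    ∑' i, rankedWeights p.1 i * ∑' k, if k ≠ i ∧ p.2 k = p.2 i then rankedWeights p.1 k else 0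
    with hD
  have hw (i : ℕ) : Measurable fun p : (ℕ → ℝ) × (ℕ → ι) => rankedWeights p.1 i :=
    (measurable_rankedWeights i).comp measurable_fst
  have hset (k i : ℕ) : MeasurableSet {ℓ : ℕ → ι | ℓ k = ℓ i} :=
    measurableSet_eq_fun (measurable_pi_apply k) (measurable_pi_apply i)
  have hDm : Measurable D := by
    refine Measurable.tsum fun i => (hw i).mul (Measurable.tsum fun k => ?_)
    by_cases hki : k = i
    · simp [hki]
    · simp only [ne_eq, hki, not_false_eq_true, true_and]
      exact Measurable.ite (measurable_snd (hset k i)) (hw k) measurable_const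
  have hD1 : ∫⁻ p, D p ∂Q ≤ (Fintype.card ι : ℝ≥0∞)⁻¹ := by
    rw [hQ, lintegral_prod _ hDm.aemeasurable]
    calc ∫⁻ U, ∫⁻ ℓ, D (U, ℓ) ∂Measure.infinitePi (fun _ : ℕ => κ) ∂betaSequenceLaw (1 / 2) 0
        ≤ ∫⁻ _, (Fintype.card ι : ℝ≥0∞)⁻¹ ∂betaSequenceLaw (1 / 2) 0 := by
          refine lintegral_mono_ae ?_
          filter_upwards [ae_tsum_rankedWeights] with U hU
          have hm (i k : ℕ) : Measurable fun ℓ : ℕ → ι =>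
              if k ≠ i ∧ ℓ k = ℓ i then rankedWeights U k else 0 := by
            by_cases hki : k = i
            · simp [hki]
            · simp only [ne_eq, hki, not_false_eq_true, true_and]
              exact Measurable.ite (hset k i) measurable_const measurable_const
          simp only [hD]
          rw [lintegral_tsum fun i => ((Measurable.tsum fun k => hm i k).const_mul _).aemeasurable]
          have (i : ℕ) : ∫⁻ ℓ, rankedWeights U i *
              ∑' k, (if k ≠ i ∧ ℓ k = ℓ i then rankedWeights U k else 0)
              ∂Measure.infinitePi (fun _ : ℕ => κ) ≤
              rankedWeights U i * (Fintype.card ι : ℝ≥0∞)⁻¹ := by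
            rw [lintegral_const_mul _ (Measurable.tsum fun k => hm i k),
              lintegral_tsum fun k => (hm i k).aemeasurable]
            gcongr
            calc _ ≤ ∑' k, rankedWeights U k * (Fintype.card ι : ℝ≥0∞)⁻¹ := by
                  refine ENNReal.tsum_le_tsum fun k => ?_
                  by_cases hki : k = i
                  · simp [hki]
                  · simp only [ne_eq, hki, not_false_eq_true, true_and]
                    rw [← infinitePi_eval_eq_eval hκ hki, ← lintegral_indicator_const (hset k i)]
                    simp only [Set.indicator_apply, Set.mem_ofPred_eq, le_refl]
              _ = _ := by rw [ENNReal.tsum_mul_right, hU, one_mul]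
          refine (ENNReal.tsum_le_tsum this).trans ?_
          rw [ENNReal.tsum_mul_right, hU, one_mul]
      _ = _ := by rw [lintegral_const, measure_univ, mul_one]
  have hfm : Measurable fun x : ι → ℝ => ∑ j, ENNReal.ofReal (x j) * ENNReal.ofReal (g (x j)) := by
    fun_prop
  have hlm : Measurable fun U : ℕ → ℝ =>
      ∑' i, rankedWeights U i * ENNReal.ofReal (g (rankedWeights U i).toReal) :=
    Measurable.tsum fun i => (measurable_rankedWeights i).mul
      (hg.comp (measurable_rankedWeights i).ennreal_toReal).ennreal_ofReal
  have hleft : ∫⁻ U, ∑' i, rankedWeights U i * ENNReal.ofReal (g (rankedWeights U i).toReal)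
        ∂betaSequenceLaw (1 / 2) 0 =
      ∫⁻ p, ∑' i, rankedWeights p.1 i * ENNReal.ofReal (g (rankedWeights p.1 i).toReal) ∂Q :=
    ((measurePreserving_fst (μ := betaSequenceLaw (1 / 2) 0)
      (ν := Measure.infinitePi fun _ : ℕ => κ)).lintegral_comp hlm).symm
  rw [hleft, blockMassLaw, lintegral_map hfm measurable_toReal_blockMass]
  refine le_trans ?_ (add_le_add_right (mul_le_mul_right hD1 (K : ℝ≥0∞)) _)
  rw [← lintegral_const_mul _ hDm, ← lintegral_add_right _ (hDm.const_mul _)]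
  refine lintegral_mono_ae ?_
  filter_upwards [ae_prod_tsum_rankedWeights (Measure.infinitePi fun _ : ℕ => κ)] with p hp
  have hb (j : ι) : blockMass (rankedWeights p.1) p.2 j ≤ 1 := blockMass_le_one hp p.2 j
  have hb' (j : ι) : blockMass (rankedWeights p.1) p.2 j ≠ ⊤ :=
    ((hb j).trans_lt ENNReal.one_lt_top).ne
  have e : ∑ j, ENNReal.ofReal (blockMass (rankedWeights p.1) p.2 j).toReal *
      ENNReal.ofReal (g (blockMass (rankedWeights p.1) p.2 j).toReal) =
      ∑' i, rankedWeights p.1 i *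
        ENNReal.ofReal (g (blockMass (rankedWeights p.1) p.2 (p.2 i)).toReal) := by
    simp only [ENNReal.ofReal_toReal (hb' _)]
    exact sum_blockMass_mul _ _ fun j =>
      ENNReal.ofReal (g (blockMass (rankedWeights p.1) p.2 j).toReal)
  rw [e]
  simp only [hD]
  rw [← ENNReal.tsum_mul_left, ← ENNReal.tsum_add]
  refine ENNReal.tsum_le_tsum fun i => ?_
  rw [mul_left_comm, ← mul_add]
  gcongr
  -- The block of atom i has mass w_i + R, so replacing the block mass by w_i inside `g` costs at
  -- most K R; weighted by w_i, these errors add up to K D.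
  set R := ∑' k, if k ≠ i ∧ p.2 k = p.2 i then rankedWeights p.1 k else 0
  have hbs : blockMass (rankedWeights p.1) p.2 (p.2 i) = rankedWeights p.1 i + R :=
    blockMass_self _ _ _
  have hle := hb (p.2 i)
  rw [hbs] at hle ⊢
  have hwt : rankedWeights p.1 i ≠ ⊤ := ((le_self_add.trans hle).trans_lt ENNReal.one_lt_top).ne
  have hRt : R ≠ ⊤ := ((le_add_self.trans hle).trans_lt ENNReal.one_lt_top).ne
  have hmem {a : ℝ≥0∞} (ha : a ≤ 1) : a.toReal ∈ Set.Icc (0 : ℝ) 1 :=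
    ⟨ENNReal.toReal_nonneg, by simpa using ENNReal.toReal_mono ENNReal.one_ne_top ha⟩
  have hlip := hK.dist_le_mul _ (hmem (le_self_add.trans hle)) _ (hmem hle)
  rw [ENNReal.toReal_add hwt hRt, Real.dist_eq, Real.dist_eq] at hlip
  have h1 : g (rankedWeights p.1 i).toReal ≤
      g ((rankedWeights p.1 i).toReal + R.toReal) + K * R.toReal := by
    have : |(rankedWeights p.1 i).toReal - ((rankedWeights p.1 i).toReal + R.toReal)| = R.toReal := by
      rw [sub_add_cancel_left, abs_neg, abs_of_nonneg ENNReal.toReal_nonneg]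
    rw [this] at hlip
    linarith [le_abs_self (g (rankedWeights p.1 i).toReal -
      g ((rankedWeights p.1 i).toReal + R.toReal))]
  rw [ENNReal.toReal_add hwt hRt]
  refine (ENNReal.ofReal_le_ofReal h1).trans (ENNReal.ofReal_add_le.trans ?_)
  rw [ENNReal.ofReal_mul K.coe_nonneg, ENNReal.ofReal_toReal hRt, ENNReal.ofReal_coe_nnreal]

end blockMass

variable {S : Type*} [MeasurableSpace S]

/-! ### The law of the masses of the blocks of a partition -/

/-- The vector of the masses of the blocks `{x | lab x = j}`. -/
def masses {N : ℕ} (lab : S → Fin N) (μ : ProbabilityMeasure S) (j : Fin N) : ℝ :=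
  (μ : Measure S).real (lab ⁻¹' {j})

theorem measurable_masses {N : ℕ} {lab : S → Fin N} (hlab : Measurable lab) :
    Measurable (masses lab) := by
  refine measurable_pi_lambda _ fun j => ?_
  exact ((Measure.measurable_coe (hlab (measurableSet_singleton j))).comp
    measurable_subtype_coe).ennreal_toReal

theorem sum_masses {N : ℕ} {lab : S → Fin N} (hlab : Measurable lab) (μ : ProbabilityMeasure S) :
    ∑ j, masses lab μ j = 1 := by
  have h := measureReal_biUnion_finset (μ := (μ : Measure S)) (s := Finset.univ)
    (f := fun j : Fin N => lab ⁻¹' {j})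
    (fun i _ j _ hij => Disjoint.preimage _ (by simpa using hij))
    (fun j _ => hlab (measurableSet_singleton j))
  unfold masses
  rw [← h]
  have : ⋃ j ∈ (Finset.univ : Finset (Fin N)), lab ⁻¹' {j} = Set.univ := by
    ext x
    simp
  rw [this, probReal_univ]

/-- Block masses depend on the atoms only through their labels, which are i.i.d. with the image law
of ν₀. The identity of the maps holds almost surely, off the event where `randomMeasure` takes its
default value. -/
theorem map_masses_dirichletLaw (ν₀ : ProbabilityMeasure S) {N : ℕ} {lab : S → Fin N}
    (hlab : Measurable lab) :
    (dirichletLaw (1 / 2) 0 ν₀).map (masses lab) =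
      blockMassLaw ((ν₀ : Measure S).map lab) := by
  have : IsProbabilityMeasure ((ν₀ : Measure S).map lab) :=
    Measure.isProbabilityMeasure_map hlab.aemeasurable
  have hm : Measurable fun (ξ : ℕ → S) i => lab (ξ i) :=
    measurable_pi_lambda _ fun i => hlab.comp (measurable_pi_apply i)
  have hprod : (betaSequenceLaw (1 / 2) 0).prod
      (Measure.infinitePi fun _ : ℕ => (ν₀ : Measure S).map lab) =
      ((betaSequenceLaw (1 / 2) 0).prod (Measure.infinitePi fun _ : ℕ => (ν₀ : Measure S))).map
        (Prod.map id fun ξ i => lab (ξ i)) := by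
    rw [← Measure.map_prod_map _ _ measurable_id hm, Measure.map_id,
      Measure.infinitePi_map_pi _ fun _ => hlab]
  rw [blockMassLaw, hprod, dirichletLaw,
    Measure.map_map (measurable_masses hlab) (measurable_randomMeasure ν₀),
    Measure.map_map measurable_toReal_blockMass (measurable_id.prodMap hm)]
  refine Measure.map_congr ?_
  filter_upwards [ae_prod_tsum_rankedWeights
    (Measure.infinitePi fun _ : ℕ => (ν₀ : Measure S))] with p hp
  have hpr : IsProbabilityMeasure (atomicMeasure p) := ⟨by
    rw [atomicMeasure, Measure.sum_apply _ MeasurableSet.univ]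
    simpa using hp⟩
  funext j
  have hj := hlab (measurableSet_singleton j)
  have hr : (randomMeasure ν₀ p : Measure S) = atomicMeasure p := by
    simp [randomMeasure, hpr]
  simp only [Function.comp_apply, masses, Measure.real, Prod.map_fst, Prod.map_snd, id]
  congr 1
  rw [hr, atomicMeasure, Measure.sum_apply _ hj, blockMass]
  refine tsum_congr fun i => ?_
  rw [Measure.smul_apply, Measure.dirac_apply' _ hj, smul_eq_mul]
  by_cases h : lab (p.2 i) = j <;> simp [h]

/-! ### Signed sums over the blocks as test functions -/

/-- The cylinder function `μ ↦ ∑ j, s j * φ (μ {x | lab x = j})`. -/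
def signedCylinder {N : ℕ} (hN : 1 ≤ N) (lab : S → Fin N) (hlab : Measurable lab) (s : Fin N → ℝ)
    (φ : ℝ → ℝ) (hφ : ContDiff ℝ ∞ φ) : CylinderFunction S where
  dim := N
  one_le_dim := hN
  φ := fun j => (lab ⁻¹' {j}).indicator 1
  measurable_φ := fun j => measurable_one.indicator (hlab (measurableSet_singleton j))
  bounded_φ := fun j => ⟨1, fun x => by by_cases h : lab x = j <;> simp [h]⟩
  f := fun v => ∑ j, s j * φ (v j)
  contDiff_f := ContDiff.sum fun j _ => contDiff_const.mul (hφ.comp (contDiff_apply ℝ ℝ j))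

section signedCylinder

variable {N : ℕ} (hN : 1 ≤ N) {lab : S → Fin N} (hlab : Measurable lab) (s : Fin N → ℝ)
  {φ φ' : ℝ → ℝ} (hφ : ContDiff ℝ ∞ φ)

theorem coords_signedCylinder (μ : ProbabilityMeasure S) :
    (signedCylinder hN lab hlab s φ hφ).coords μ = masses lab μ :=
  funext fun j => integral_indicator_one (hlab (measurableSet_singleton j))

theorem eval_signedCylinder (μ : ProbabilityMeasure S) :
    (signedCylinder hN lab hlab s φ hφ).eval μ = ∑ j, s j * φ (masses lab μ j) := by
  unfold CylinderFunction.eval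
  rw [coords_signedCylinder]
  rfl

theorem grad_signedCylinder (hd : ∀ v, HasDerivAt φ (φ' v) v) (μ : ProbabilityMeasure S) (x : S) :
    (signedCylinder hN lab hlab s φ hφ).grad μ x =
      ∑ j, s j * φ' (masses lab μ j) * (lab ⁻¹' {j}).indicator 1 x := by
  unfold CylinderFunction.grad
  rw [coords_signedCylinder]
  have hF : HasFDerivAt (fun v : Fin N → ℝ => ∑ j, s j * φ (v j))
      (∑ j, s j • (φ' (masses lab μ j) • ContinuousLinearMap.proj (R := ℝ) (φ := fun _ => ℝ) j))
      (masses lab μ) := by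
    refine HasFDerivAt.fun_sum fun j _ => HasFDerivAt.const_mul ?_ (s j)
    exact (hd (masses lab μ j)).comp_hasFDerivAt (f := fun v : Fin N → ℝ => v j) (masses lab μ)
      (ContinuousLinearMap.proj (R := ℝ) (φ := fun _ : Fin N => ℝ) j).hasFDerivAt
  have hFi (i : Fin N) : fderiv ℝ (fun v : Fin N → ℝ => ∑ j, s j * φ (v j)) (masses lab μ)
      (Pi.single i 1) = s i * φ' (masses lab μ i) := by
    rw [hF.fderiv, sum_apply, Finset.sum_eq_single i]
    · simp
    · intro j _ hj
      simp [Pi.single_eq_of_ne hj]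
    · simp
  exact Finset.sum_congr rfl fun i _ => congrArg (· * (lab ⁻¹' {i}).indicator 1 x) (hFi i)

theorem grad_mass (A : Set S) (hA : MeasurableSet A) (μ : ProbabilityMeasure S) (x : S) :
    (CylinderFunction.mass A hA).grad μ x = A.indicator 1 x := by
  unfold CylinderFunction.grad CylinderFunction.mass
  have h : HasFDerivAt (fun v : Fin 1 → ℝ => v 0)
      (ContinuousLinearMap.proj (R := ℝ) (φ := fun _ : Fin 1 => ℝ) 0)
      ((CylinderFunction.mass A hA).coords μ) :=
    (ContinuousLinearMap.proj (R := ℝ) (φ := fun _ : Fin 1 => ℝ) 0).hasFDerivAt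
  have h' := h.fderiv
  unfold CylinderFunction.mass at h'
  simp [h']

/-- On the blocks 1_A = (1 + s)/2, and the constant 1/2 has no covariance with anything, so only
half the covariance with s remains; s² = 1 removes the signs from its first term. -/
theorem covForm_grad_mass_signedCylinder (hd : ∀ v, HasDerivAt φ (φ' v) v) {A : Set S}
    (hA : MeasurableSet A) (hs : ∀ j, s j * s j = 1) (hAs : ∀ x, x ∈ A ↔ s (lab x) = 1)
    (μ : ProbabilityMeasure S) :
    covForm μ ((CylinderFunction.mass A hA).grad μ)
        ((signedCylinder hN lab hlab s φ hφ).grad μ) =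
      1 / 2 * (∑ i, masses lab μ i * φ' (masses lab μ i) -
        ∑ i, ∑ j, s i * s j *
          (masses lab μ i * (masses lab μ j * φ' (masses lab μ j)))) := by
  have hm (j : Fin N) := hlab (measurableSet_singleton j)
  have hint (j : Fin N) : Integrable ((lab ⁻¹' {j}).indicator (1 : S → ℝ)) (μ : Measure S) :=
    (integrable_const (1 : ℝ)).indicator (hm j)
  have hsum (x : S) (c : Fin N → ℝ) : ∑ j, c j * (lab ⁻¹' {j}).indicator 1 x = c (lab x) := by
    rw [Finset.sum_eq_single (lab x)]
    · simp
    · intro j _ hj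
      simp [hj.symm]
    · simp
  have hcint (c : Fin N → ℝ) : ∫ x, c (lab x) ∂(μ : Measure S) = ∑ j, c j * masses lab μ j := by
    rw [integral_congr_ae (ae_of_all _ fun x => (hsum x c).symm)]
    rw [integral_finsetSum _ fun j _ => (hint j).const_mul _]
    refine Finset.sum_congr rfl fun j _ => ?_
    rw [integral_const_mul, integral_indicator_one (hm j)]
    rfl
  have hAi (x : S) : A.indicator (1 : S → ℝ) x = (1 + s (lab x)) / 2 := by
    rcases mul_self_eq_one_iff.1 (hs (lab x)) with h | h
    · rw [Set.indicator_of_mem ((hAs x).2 h), h]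
      norm_num
    · rw [Set.indicator_of_notMem (fun hx => by rw [(hAs x).1 hx] at h; norm_num at h), h]
      norm_num
  simp only [covForm, grad_mass, grad_signedCylinder hN hlab s hφ hd, hsum, hAi]
  rw [hcint fun j => (1 + s j) / 2 * (s j * φ' (masses lab μ j)), hcint fun j => (1 + s j) / 2,
    hcint fun j => s j * φ' (masses lab μ j)]
  have h1 := sum_masses hlab μ
  set x := masses lab μ
  have e1 : ∑ j, (1 + s j) / 2 * (s j * φ' (x j)) * x j =
      1 / 2 * (∑ j, s j * φ' (x j) * x j + ∑ j, x j * φ' (x j)) := by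
    rw [← Finset.sum_add_distrib, Finset.mul_sum]
    exact Finset.sum_congr rfl fun j _ => by linear_combination (φ' (x j) * x j / 2) * hs j
  have e2 : ∑ j, (1 + s j) / 2 * x j = 1 / 2 * (1 + ∑ j, s j * x j) := by
    have : ∑ j, (1 + s j) / 2 * x j = 1 / 2 * (∑ j, x j + ∑ j, s j * x j) := by
      rw [← Finset.sum_add_distrib, Finset.mul_sum]
      exact Finset.sum_congr rfl fun j _ => by ring
    rw [this, h1]
  have e3 : ∑ i, ∑ j, s i * s j * (x i * (x j * φ' (x j))) =
      (∑ j, s j * x j) * ∑ j, s j * φ' (x j) * x j := by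
    rw [Finset.sum_mul_sum]
    exact Finset.sum_congr rfl fun i _ => Finset.sum_congr rfl fun j _ => by ring
  rw [e1, e2, e3]
  ring

end signedCylinder

/-! ### The energy bound -/

/-- If `LH` represents `𝓔(H, ·)` for `H(μ) = μ(A)`, then the expectation of
`∑ j, M j (1 - M j) φ'(M j)`, with `φ = smoothSqrt ε` and the masses `M j` of equiprobable blocks,
is bounded uniformly in `ε` and the number of blocks. -/
theorem integral_diag_blockMassLaw_le {ν₀ : ProbabilityMeasure S} {A : Set S}
    (hA : MeasurableSet A) {LH : ProbabilityMeasure S → ℝ}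
    (hLH : MemLp LH 2 (dirichletLaw (1 / 2) 0 ν₀))
    (h : ∀ G : CylinderFunction S,
      energyForm (dirichletLaw (1 / 2) 0 ν₀) (CylinderFunction.mass A hA) G =
        ∫ μ, -LH μ * G.eval μ ∂dirichletLaw (1 / 2) 0 ν₀)
    {N : ℕ} (hN : 1 ≤ N) {lab : S → Fin N} (hlab : Measurable lab)
    (hκ : ∀ j, (ν₀ : Measure S).map lab {j} = (Fintype.card (Fin N) : ℝ≥0∞)⁻¹) {s : Fin N → ℝ}
    (hs : ∀ j, s j * s j = 1) (hs0 : ∑ j, s j = 0) (hAs : ∀ x, x ∈ A ↔ s (lab x) = 1)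
    {ε : ℝ} (hε : 0 < ε) :
    ∫ x, ∑ i, x i * ((1 - x i) * smoothSqrtDeriv ε (x i)) ∂blockMassLaw ((ν₀ : Measure S).map lab)
      ≤ 2 * (∫ μ, LH μ ^ 2 ∂dirichletLaw (1 / 2) 0 ν₀ + 1) := by
  have : IsProbabilityMeasure ((ν₀ : Measure S).map lab) :=
    Measure.isProbabilityMeasure_map hlab.aemeasurable
  have hΛ := isExchangeableOnSimplex_blockMassLaw hκ
  have hmap := map_masses_dirichletLaw ν₀ hlab
  have hmm := measurable_masses hlab
  set P := dirichletLaw (1 / 2) 0 ν₀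
  set Λ := blockMassLaw ((ν₀ : Measure S).map lab)
  have hφ := contDiff_smoothSqrt hε
  have hφc : Continuous (smoothSqrt ε) := hφ.continuous
  have hφc' : Continuous (smoothSqrtDeriv ε) := (contDiff_smoothSqrtDeriv hε).continuous
  set G := signedCylinder hN lab hlab s (smoothSqrt ε) hφ
  have htrans {f : (Fin N → ℝ) → ℝ} (hf : Continuous f) :
      ∫ μ, f (masses lab μ) ∂P = ∫ x, f x ∂Λ := by
    rw [← hmap, integral_map hmm.aemeasurable hf.aestronglyMeasurable]
  have htransi {f : (Fin N → ℝ) → ℝ} (hf : Continuous f) :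
      Integrable (fun μ => f (masses lab μ)) P := by
    have hi := hΛ.integrable_of_continuous hf
    rw [← hmap] at hi
    exact hi.comp_measurable hmm
  -- The factor 1/4 combines the 1/2 in the form with the 1/2 from 1_A = (1 + s)/2.
  have hE : energyForm P (CylinderFunction.mass A hA) G = 1 / 4 *
      ∫ x, (∑ i, x i * smoothSqrtDeriv ε (x i) -
        ∑ i, ∑ j, s i * s j * (x i * (x j * smoothSqrtDeriv ε (x j)))) ∂Λ := by
    unfold energyForm
    simp only [G, covForm_grad_mass_signedCylinder hN hlab s hφ (hasDerivAt_smoothSqrt hε) hA hs hAs]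
    rw [integral_const_mul, htrans (f := fun x => ∑ i, x i * smoothSqrtDeriv ε (x i) -
        ∑ i, ∑ j, s i * s j * (x i * (x j * smoothSqrtDeriv ε (x j)))) (by fun_prop)]
    ring
  have hlow := hΛ.integral_diag_le hs hs0 hφc' fun v hv => smoothSqrtDeriv_nonneg ε hv
  have hGe (μ : ProbabilityMeasure S) : G.eval μ = ∑ j, s j * smoothSqrt ε (masses lab μ j) :=
    eval_signedCylinder hN hlab s hφ μ
  have hG2 : ∫ μ, G.eval μ ^ 2 ∂P ≤ 1 := by
    simp only [hGe]
    rw [htrans (f := fun x => (∑ j, s j * smoothSqrt ε (x j)) ^ 2) (by fun_prop)]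
    exact hΛ.integral_sq_signed_sum_le hs hs0 hφc (smoothSqrt_nonneg ε)
      fun v hv => smoothSqrt_sq_le hε hv
  have hG2i : Integrable (fun μ => G.eval μ ^ 2) P := by
    simp only [hGe]
    exact htransi (f := fun x => (∑ j, s j * smoothSqrt ε (x j)) ^ 2) (by fun_prop)
  have hGm : AEStronglyMeasurable G.eval P := by
    have : G.eval = fun μ => ∑ j, s j * smoothSqrt ε (masses lab μ j) := funext hGe
    rw [this]
    exact (htransi (f := fun x => ∑ j, s j * smoothSqrt ε (x j)) (by fun_prop)).1
  have hGL : MemLp G.eval 2 P := (memLp_two_iff_integrable_sq hGm).2 hG2i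
  have hLi : Integrable (fun μ => LH μ ^ 2) P := hLH.integrable_sq
  have hprod : Integrable (fun μ => -LH μ * G.eval μ) P := hLH.neg.integrable_mul hGL
  -- Young's inequality -ab ≤ (a² + b²)/2; with E G² ≤ 1 and the factor 1/4 it gives the constant 2
  -- (∫ LH² + 1).
  have hup : ∫ μ, -LH μ * G.eval μ ∂P ≤ ∫ μ, (1 / 2 * LH μ ^ 2 + 1 / 2 * G.eval μ ^ 2) ∂P := by
    refine integral_mono hprod ((hLi.const_mul _).add (hG2i.const_mul _)) fun μ => ?_
    simp only
    nlinarith [sq_nonneg (LH μ + G.eval μ)]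
  rw [integral_add (hLi.const_mul _) (hG2i.const_mul _), integral_const_mul,
    integral_const_mul] at hup
  have hG := h G
  rw [hE] at hG
  linarith

/-! ### Dyadic partitions -/

namespace IsDyadicPartition

variable {ν₀ : ProbabilityMeasure S} {B : ℕ → ℕ → Set S}

theorem one_one_eq_biUnion (hB : IsDyadicPartition ν₀ B) (k : ℕ) :
    B 1 1 = ⋃ j ∈ Finset.Icc 1 (2 ^ k), B (k + 1) j := by
  induction k with
  | zero => simp
  | succ k ih =>
    rw [ih]
    ext x
    simp only [Set.mem_iUnion, Finset.mem_Icc, exists_prop]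
    constructor
    · rintro ⟨j, hj, hx⟩
      rw [hB.split (k + 1) (by omega) j
        (Finset.mem_Icc.2 ⟨hj.1, by rw [pow_succ]; omega⟩)] at hx
      rcases hx with hx | hx
      · exact ⟨_, ⟨by omega, by rw [pow_succ]; omega⟩, hx⟩
      · exact ⟨_, ⟨by omega, by rw [pow_succ]; omega⟩, hx⟩
    · rintro ⟨i, hi, hx⟩
      rw [pow_succ] at hi
      -- The parent of block i is ⌈i/2⌉, as blocks are numbered from 1.
      refine ⟨(i + 1) / 2, ⟨by omega, by omega⟩, ?_⟩
      rw [hB.split (k + 1) (by omega) ((i + 1) / 2)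
        (Finset.mem_Icc.2 ⟨by omega, by rw [pow_succ]; omega⟩)]
      rcases Nat.even_or_odd' i with ⟨c, rfl | rfl⟩
      · right
        rwa [show 2 * ((2 * c + 1) / 2) = 2 * c by omega]
      · left
        rwa [show 2 * ((2 * c + 1 + 1) / 2) - 1 = 2 * c + 1 by omega]

/-- The index of the block of level `k + 1` that contains a point. -/
theorem exists_label (hB : IsDyadicPartition ν₀ B) (k : ℕ) :
    ∃ lab : S → Fin (2 ^ (k + 1)), ∀ j, lab ⁻¹' {j} = B (k + 1) (j + 1) := by
  have hex (x : S) : ∃ j : Fin (2 ^ (k + 1)), x ∈ B (k + 1) (j + 1) := by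
    have hx : x ∈ ⋃ j ∈ Finset.Icc 1 (2 ^ (k + 1)), B (k + 1) j := by
      rw [hB.iUnion_eq (k + 1) (by omega)]
      trivial
    simp only [Set.mem_iUnion, Finset.mem_Icc, exists_prop] at hx
    obtain ⟨j, ⟨h1, h2⟩, hj⟩ := hx
    exact ⟨⟨j - 1, by omega⟩, by simpa [Nat.sub_add_cancel h1] using hj⟩
  choose lab hl using hex
  refine ⟨lab, fun j => ?_⟩
  ext x
  rw [Set.mem_preimage, Set.mem_singleton_iff]
  refine ⟨fun h => h ▸ hl x, fun h => ?_⟩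
  by_contra hne
  have hd := hB.disjoint (k + 1) (by omega) (lab x + 1) (by simp) (j + 1) (by simp)
    fun he => hne (Fin.ext (by omega))
  exact Set.disjoint_left.1 hd (hl x) h

theorem exists_measurable_label (hB : IsDyadicPartition ν₀ B) (k : ℕ) :
    ∃ (lab : S → Fin (2 ^ (k + 1))) (s : Fin (2 ^ (k + 1)) → ℝ), Measurable lab ∧
      (∀ j, (ν₀ : Measure S).map lab {j} = (Fintype.card (Fin (2 ^ (k + 1))) : ℝ≥0∞)⁻¹) ∧
      (∀ j, s j * s j = 1) ∧ ∑ j, s j = 0 ∧ ∀ x, x ∈ B 1 1 ↔ s (lab x) = 1 := by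
  obtain ⟨lab, hl⟩ := hB.exists_label k
  have hmem (j : Fin (2 ^ (k + 1))) : (j : ℕ) + 1 ∈ Finset.Icc 1 (2 ^ (k + 1)) := by
    simp only [Finset.mem_Icc]
    omega
  have hlab : Measurable lab := by
    refine measurable_to_countable' fun j => ?_
    rw [hl]
    exact hB.measurableSet (k + 1) (by omega) _ (hmem j)
  -- Labels start at 0 and blocks at 1, so the labels below 2^k are exactly the blocks that make up
  -- B^1_1, half of all blocks.
  refine ⟨lab, fun j => if (j : ℕ) < 2 ^ k then 1 else -1, hlab, fun j => ?_, fun j => ?_, ?_,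
    fun x => ?_⟩
  · rw [Measure.map_apply hlab (measurableSet_singleton j), hl,
      hB.measure_eq (k + 1) (by omega) _ (hmem j)]
    simp
  · dsimp only
    split_ifs <;> norm_num
  · rw [Fin.sum_univ_eq_sum_range (fun j => if j < 2 ^ k then (1 : ℝ) else -1), pow_succ, mul_two,
      Finset.sum_range_add]
    have h1 : ∑ i ∈ Finset.range (2 ^ k), (if i < 2 ^ k then (1 : ℝ) else -1) = 2 ^ k := by
      rw [Finset.sum_congr rfl fun i hi => if_pos (Finset.mem_range.1 hi)]
      simp
    have h2 : ∑ i ∈ Finset.range (2 ^ k), (if 2 ^ k + i < 2 ^ k then (1 : ℝ) else -1) =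
        -2 ^ k := by
      rw [Finset.sum_congr rfl fun i _ => if_neg (by omega : ¬ 2 ^ k + i < 2 ^ k)]
      simp
    rw [h1, h2, add_neg_cancel]
  · have hx : x ∈ B (k + 1) (lab x + 1) := by
      rw [← hl]
      rfl
    have key : x ∈ B 1 1 ↔ (lab x : ℕ) < 2 ^ k := by
      rw [hB.one_one_eq_biUnion k]
      simp only [Set.mem_iUnion, Finset.mem_Icc, exists_prop]
      constructor
      · rintro ⟨j, ⟨h1, h2⟩, hj⟩
        have h3 : j - 1 < 2 ^ (k + 1) := by
          rw [pow_succ]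
          omega
        have h4 : x ∈ lab ⁻¹' {⟨j - 1, h3⟩} := by
          rw [hl]
          simpa [Nat.sub_add_cancel h1] using hj
        rw [Set.mem_preimage, Set.mem_singleton_iff] at h4
        rw [h4]
        dsimp only
        omega
      · exact fun h => ⟨_, ⟨by omega, by omega⟩, hx⟩
    rw [key]
    by_cases h : (lab x : ℕ) < 2 ^ k
    · simp [h]
    · simp only [h, if_false, false_iff]
      norm_num

end IsDyadicPartition

/-! ### Divergence -/

/-- No bound on the expectation of `∑ i, P i (1 - P i) φ'(P i)`, with `φ = smoothSqrt ε` and the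
ranked weights `P i`, is uniform in `ε`. -/
theorem exists_lt_lintegral_tsum_rankedWeights {C : ℝ≥0∞} (hC : C ≠ ⊤) :
    ∃ ε : ℝ, 0 < ε ∧ C < ∫⁻ U, ∑' i, rankedWeights U i * ENNReal.ofReal
      ((1 - (rankedWeights U i).toReal) * smoothSqrtDeriv ε (rankedWeights U i).toReal)
        ∂betaSequenceLaw (1 / 2) 0 := by
  by_contra! hcon
  set g : ℝ → ℝ → ℝ := fun ε v => (1 - v) * smoothSqrtDeriv ε v with hg
  have hgm (n : ℕ) : Measurable (g (1 / ((n : ℝ) + 1))) := by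
    have := (contDiff_smoothSqrtDeriv (ε := 1 / ((n : ℝ) + 1)) (by positivity)).continuous
    simp only [hg]
    fun_prop
  -- The second term on the right equals √a (1 - a), and the defect a √a is at most a because a ≤ 1.
  -- At a = 0 the division by zero is harmless, since it is multiplied by a.
  have hle (a : ℝ≥0∞) (ha : a ≤ 1) : a ^ (1 / 2 : ℝ) ≤ a +
      2 * (a * ENNReal.ofReal ((1 - a.toReal) * (1 / (2 * √a.toReal)))) := by
    have hat : a ≠ ⊤ := (ha.trans_lt ENNReal.one_lt_top).ne
    obtain ⟨v, hv, rfl⟩ : ∃ v : ℝ, 0 ≤ v ∧ a = ENNReal.ofReal v :=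
      ⟨a.toReal, ENNReal.toReal_nonneg, (ENNReal.ofReal_toReal hat).symm⟩
    rw [ENNReal.ofReal_le_one] at ha
    rw [ENNReal.toReal_ofReal hv, ENNReal.ofReal_rpow_of_nonneg hv (by norm_num),
      ← Real.sqrt_eq_rpow, ← ENNReal.ofReal_ofNat 2, ← ENNReal.ofReal_mul hv,
      ← ENNReal.ofReal_mul (by norm_num), ← ENNReal.ofReal_add hv]
    · refine ENNReal.ofReal_le_ofReal ?_
      rcases hv.eq_or_lt with rfl | hv'
      · simp
      · have hq : 0 < √v := Real.sqrt_pos.2 hv'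
        have hqq : √v * √v = v := Real.mul_self_sqrt hv
        have hq1 : √v ≤ 1 := Real.sqrt_le_one.2 ha
        have : 2 * (v * ((1 - v) * (1 / (2 * √v)))) = √v * (1 - v) := by
          field_simp
          nlinarith
        rw [this]
        nlinarith
    · have : 0 ≤ 1 - v := sub_nonneg.2 ha
      positivity
  have hlim (a : ℝ≥0∞) (ha : a ≤ 1) :
      Filter.Tendsto (fun n : ℕ => a * ENNReal.ofReal (g (1 / ((n : ℝ) + 1)) a.toReal)) Filter.atTop
        (nhds (a * ENNReal.ofReal ((1 - a.toReal) * (1 / (2 * √a.toReal))))) := by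
    have hat : a ≠ ⊤ := (ha.trans_lt ENNReal.one_lt_top).ne
    rcases eq_or_ne a 0 with rfl | ha0
    · simp
    · refine ENNReal.Tendsto.const_mul (ENNReal.tendsto_ofReal ?_) (Or.inr hat)
      exact (tendsto_smoothSqrtDeriv (ENNReal.toReal_pos ha0 hat)).const_mul _
  have hwle {U : ℕ → ℝ} (hU : ∑' k, rankedWeights U k = 1) (i : ℕ) : rankedWeights U i ≤ 1 :=
    hU ▸ ENNReal.le_tsum i
  -- Fatou's lemma along ε = 1/(n+1), applied to finite partial sums, for which the limit may be
  -- taken term by term.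
  have hbound (m : ℕ) : ∫⁻ U, ∑ i ∈ Finset.range m, rankedWeights U i * ENNReal.ofReal
      ((1 - (rankedWeights U i).toReal) * (1 / (2 * √(rankedWeights U i).toReal)))
        ∂betaSequenceLaw (1 / 2) 0 ≤ C := by
    calc _ ≤ ∫⁻ U, Filter.liminf (fun n : ℕ => ∑ i ∈ Finset.range m, rankedWeights U i *
          ENNReal.ofReal (g (1 / ((n : ℝ) + 1)) (rankedWeights U i).toReal)) Filter.atTop
            ∂betaSequenceLaw (1 / 2) 0 := by
          refine lintegral_mono_ae ?_
          filter_upwards [ae_tsum_rankedWeights] with U hU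
          exact (tendsto_finsetSum _ fun i _ => hlim _ (hwle hU i)).liminf_eq.ge
      _ ≤ _ := lintegral_liminf_le fun n => Finset.measurable_fun_sum _ fun i _ =>
          (measurable_rankedWeights i).mul
            ((hgm n).comp (measurable_rankedWeights i).ennreal_toReal).ennreal_ofReal
      _ ≤ Filter.liminf (fun _ : ℕ => C) Filter.atTop := by
          refine Filter.liminf_le_liminf (Filter.Eventually.of_forall fun n => ?_)
          refine (lintegral_mono fun U => ?_).trans (hcon (1 / ((n : ℝ) + 1)) (by positivity))
          exact ENNReal.sum_le_tsum _
      _ = C := Filter.liminf_const C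
  have hm (i : ℕ) : Measurable fun U : ℕ → ℝ => rankedWeights U i * ENNReal.ofReal
      ((1 - (rankedWeights U i).toReal) * (1 / (2 * √(rankedWeights U i).toReal))) := by
    have := (measurable_rankedWeights i).ennreal_toReal
    exact (measurable_rankedWeights i).mul (by fun_prop)
  have htot : ∫⁻ U, ∑' i, rankedWeights U i * ENNReal.ofReal
      ((1 - (rankedWeights U i).toReal) * (1 / (2 * √(rankedWeights U i).toReal)))
        ∂betaSequenceLaw (1 / 2) 0 ≤ C := by
    rw [lintegral_tsum fun i => (hm i).aemeasurable, ENNReal.tsum_eq_iSup_nat]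
    refine iSup_le fun m => ?_
    rw [← lintegral_finsetSum _ fun i _ => hm i]
    exact hbound m
  have hfin : ∫⁻ U, ∑' k, rankedWeights U k ^ (1 / 2 : ℝ) ∂betaSequenceLaw (1 / 2) 0 ≤
      1 + 2 * C := by
    calc _ ≤ ∫⁻ U, (1 + 2 * ∑' i, rankedWeights U i * ENNReal.ofReal
          ((1 - (rankedWeights U i).toReal) * (1 / (2 * √(rankedWeights U i).toReal))))
            ∂betaSequenceLaw (1 / 2) 0 := by
          refine lintegral_mono_ae ?_
          filter_upwards [ae_tsum_rankedWeights] with U hU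
          calc _ ≤ _ := ENNReal.tsum_le_tsum fun i => hle _ (hwle hU i)
            _ = _ := by rw [ENNReal.tsum_add, hU, ENNReal.tsum_mul_left]
      _ ≤ _ := by
          rw [lintegral_add_left measurable_const, lintegral_const_mul _ (Measurable.tsum hm),
            lintegral_one, measure_univ]
          gcongr
  rw [lintegral_tsum_sqrt_rankedWeights, top_le_iff] at hfin
  exact ENNReal.add_ne_top.2 ⟨ENNReal.one_ne_top, ENNReal.mul_ne_top ENNReal.ofNat_ne_top hC⟩ hfin

end TwoParameterDirichlet

end

/-! ### The contradiction: refining the partition for a fixed ε -/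

theorem proposition3p1 {S : Type*} [MetricSpace S] [LocallyCompactSpace S]
    [TopologicalSpace.SeparableSpace S] [MeasurableSpace S] [BorelSpace S]
    (ν₀ : ProbabilityMeasure S) (hν₀ : ∀ x : S, (ν₀ : Measure S) {x} = 0)
    (B : ℕ → ℕ → Set S) (hB : TwoParameterDirichlet.IsDyadicPartition ν₀ B) :
    ¬ ∃ LH : ProbabilityMeasure S → ℝ,
      MemLp LH 2 (TwoParameterDirichlet.dirichletLaw (1 / 2) 0 ν₀) ∧
      ∀ G : TwoParameterDirichlet.CylinderFunction S,
        TwoParameterDirichlet.energyForm (TwoParameterDirichlet.dirichletLaw (1 / 2) 0 ν₀)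
            (TwoParameterDirichlet.CylinderFunction.mass (B 1 1) hB.measurableSet_one_one) G =
          ∫ μ, -LH μ * G.eval μ ∂(TwoParameterDirichlet.dirichletLaw (1 / 2) 0 ν₀) := by
  open TwoParameterDirichlet in
  rintro ⟨LH, hLH, h⟩
  set C : ℝ := 2 * (∫ μ, LH μ ^ 2 ∂dirichletLaw (1 / 2) 0 ν₀ + 1)
  obtain ⟨ε, hε, hlt⟩ := exists_lt_lintegral_tsum_rankedWeights
    (C := ENNReal.ofReal C) ENNReal.ofReal_ne_top
  refine hlt.not_ge ?_
  have hcd := contDiff_smoothSqrtDeriv hε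
  have hg : ContDiff ℝ ∞ fun v => (1 - v) * smoothSqrtDeriv ε v :=
    (contDiff_const.sub contDiff_id).mul hcd
  -- The Lipschitz constant depends on ε, which is already fixed, but not on the level k; hence the
  -- error K / 2^(k+1) vanishes as k grows.
  obtain ⟨K, hK⟩ := hg.contDiffOn.exists_lipschitzOnWith (by simp) (convex_Icc (0 : ℝ) 1)
    isCompact_Icc
  have hk (k : ℕ) : ∫⁻ U, ∑' i, rankedWeights U i * ENNReal.ofReal
      ((1 - (rankedWeights U i).toReal) * smoothSqrtDeriv ε (rankedWeights U i).toReal)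
        ∂betaSequenceLaw (1 / 2) 0 ≤
      ENNReal.ofReal C + K * ((2 : ℝ≥0∞) ^ (k + 1))⁻¹ := by
    obtain ⟨lab, s, hlab, hκ, hs, hs0, hAs⟩ := hB.exists_measurable_label k
    have : IsProbabilityMeasure ((ν₀ : Measure S).map lab) :=
      Measure.isProbabilityMeasure_map hlab.aemeasurable
    have hΛ := isExchangeableOnSimplex_blockMassLaw hκ
    have hint := integral_diag_blockMassLaw_le hB.measurableSet_one_one hLH h Nat.one_le_two_pow
      hlab hκ hs hs0 hAs hε
    have hle := lintegral_tsum_rankedWeights_le hκ hg.continuous.measurable hK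
    have hcard : (Fintype.card (Fin (2 ^ (k + 1))) : ℝ≥0∞) = 2 ^ (k + 1) := by simp
    rw [hcard] at hle
    refine hle.trans ?_
    gcongr
    refine le_trans (le_of_eq ?_) (ENNReal.ofReal_le_ofReal hint)
    have hcont := hcd.continuous
    have hnn {x : Fin (2 ^ (k + 1)) → ℝ} (hx : ∀ i, x i ∈ Set.Icc (0 : ℝ) 1)
        (i : Fin (2 ^ (k + 1))) : 0 ≤ (1 - x i) * smoothSqrtDeriv ε (x i) :=
      mul_nonneg (sub_nonneg.2 (hx i).2) (smoothSqrtDeriv_nonneg ε (hx i).1)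
    -- The masses lie in [0, 1] almost surely, so the integrand is nonnegative and `ENNReal.ofReal`
    -- truncates nothing.
    rw [ofReal_integral_eq_lintegral_ofReal (hΛ.integrable_of_continuous (by fun_prop))]
    · refine lintegral_congr_ae ?_
      filter_upwards [hΛ.ae_mem_Icc] with x hx
      rw [ENNReal.ofReal_sum_of_nonneg fun i _ => mul_nonneg (hx i).1 (hnn hx i)]
      exact Finset.sum_congr rfl fun i _ => (ENNReal.ofReal_mul (hx i).1).symm
    · filter_upwards [hΛ.ae_mem_Icc] with x hx
      exact Finset.sum_nonneg fun i _ => mul_nonneg (hx i).1 (hnn hx i)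
  have hlim : Filter.Tendsto (fun k : ℕ => ENNReal.ofReal C + K * ((2 : ℝ≥0∞) ^ (k + 1))⁻¹)
      Filter.atTop (nhds (ENNReal.ofReal C + K * 0)) := by
    refine tendsto_const_nhds.add (ENNReal.Tendsto.const_mul ?_ (Or.inr ENNReal.coe_ne_top))
    simp only [ENNReal.inv_pow]
    exact (Filter.tendsto_add_atTop_iff_nat 1).2
      (ENNReal.tendsto_pow_atTop_nhds_zero_of_lt_one (by simp))
  rw [mul_zero, add_zero] at hlim
  exact ge_of_tendsto' hlim hk
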